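/- Let $\mathrm C$ be a small groupoid. A \emph{crossed module} $(A,\mathrm C)$ consists of a contravariant functor $A$ from $\mathrm C$ to groups (write $a^\alpha\in A(s)$ for the image of $a\in A(t)$ under $\alpha\in\mathrm C(s,t)$) and group homomorphisms $\partial_t\colon A(t)\to\mathrm C(t,t)$, one for each object $t$, such that $\alpha\,\partial_s(a^\alpha)=\partial_t(a)\,\alpha$ and $ab=b\,a^{\partial_t b}$ for all objects $s,t$, all $\alpha\in \mathrm C(s,t)$ and all $a,b\in A(t)$ (here $\alpha\beta$ means $\alpha\circ\beta$). Write $e_x$ for the unit of $A(x)$. Its nerve $N=N(A,\mathrm C)$ is the following simplicial set. $N_0$ is the set of objects of $\mathrm C$. For $n\ge1$, $N_n$ is the set of upper triangular matrices $M=(m_{ij})_{1\le i\le j\le n}$ for which there are objects $x_0,\dots,x_n$ with $m_{jj}\in\mathrm C(x_j,x_{j-1})$ and $m_{ij}\in A(x_i)$ for $i<j$. On $N_1$, $d_0$ is the source and $d_1$ is the target. For $n\ge 2$, $d_0$ deletes the first row and $d_n$ deletes the last column. For $0<j<n$, $d_j$ multiplies the $j$-th and $(j+1)$-st entries in each row above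 the $j$-th one, and replaces the rows $j$ and $j+1$ by the single row $$\bigl(m_{jj}\,\partial(m_{j,j+1})\,m_{j+1,j+1},\ m_{j,j+2}^{\eta_{j+1,j+1}}m_{j+1,j+2},\ \dots,\ m_{j,n}^{\eta_{j+1,n-1}}m_{j+1,n}\bigr),\qquad \eta_{j+1,k}=m_{j+1,j+1}\,\partial(m_{j+1,j+2}\cdots m_{j+1,k}).$$ The degeneracy $s_j$ inserts $e_{x_i}$ at the $(j+1)$-st place of every row $i\le j$ and inserts the new $(j+1)$-st row $(1_{x_j},e_{x_j},\dots,e_{x_j})$, starting on the diagonal; $s_0(p)=1_p$ on $N_0$. For a Kan complex $X$, a vertex $x$ and $n\ge1$, let $\pi_n(X,x)$ be the set of $y\in X_n$ all of whose faces are equal to the degenerate simplex on $x$ (again denoted $x$), modulo the relation $y\sim z$ iff some $w\in X_{n+1}$ has faces $(d_0w,\dots,d_{n+1}w)=(x,\dots,x,y,z)$. The group structure is $[y][z]=[d_nw]$ for any $w\in X_{n+1}$ with $d_iw=x$ for $i<n-1$, $d_{n-1}w=y$ and $d_{n+1}w=z$. A Kan complex is a $k$-type if $\pi_n(X,x)$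 is trivial for all $n>k$ and all vertices $x$. \textbf{Statement.} For every crossed module $(A,\mathrm C)$ the simplicial set $N(A,\mathrm C)$ is a Kan complex, and for every object $t$ of $\mathrm C$ there are isomorphisms of groups $$\pi_1(N(A,\mathrm C),t)\cong \mathrm C(t,t)/\partial_t(A(t)),\qquad \pi_2(N(A,\mathrm C),t)\cong\operatorname{Ker}(\partial_t),$$ and $\pi_n(N(A,\mathrm C),t)$ is trivial for all $n\ge3$. Hence $N(A,\mathrm C)$ is a $2$-type. -/

import Mathlib

open CategoryTheory

universe u v w

/-! ### Simplicial sets, Kan condition, homotopy groups -/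

/-- A simplicial set: a sequence of sets with face maps `d` and degeneracy maps `s`
satisfying the simplicial identities. -/
structure SimpSet where
  obj : ℕ → Type u
  d {n : ℕ} : Fin (n + 2) → obj (n + 1) → obj n
  s {n : ℕ} : Fin (n + 1) → obj n → obj (n + 1)
  d_d {n : ℕ} (i j : Fin (n + 2)) (h : i ≤ j) (x : obj (n + 2)) :
    d i (d j.succ x) = d j (d i.castSucc x)
  d_s_of_le {n : ℕ} (i : Fin (n + 2)) (j : Fin (n + 1)) (h : i ≤ j.castSucc) (x : obj (n + 1)) :
    d i.castSucc (s j.succ x) = s j (d i x)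
  d_s_self {n : ℕ} (i : Fin (n + 1)) (x : obj n) : d i.castSucc (s i x) = x
  d_s_succ {n : ℕ} (i : Fin (n + 1)) (x : obj n) : d i.succ (s i x) = x
  d_s_of_gt {n : ℕ} (i : Fin (n + 2)) (j : Fin (n + 1)) (h : j.castSucc < i) (x : obj (n + 1)) :
    d i.succ (s j.castSucc x) = s j (d i x)
  s_s {n : ℕ} (i j : Fin (n + 1)) (h : i ≤ j) (x : obj n) :
    s i.castSucc (s j x) = s j.succ (s i x)

namespace SimpSet

variable (X : SimpSet.{u})

/-- The Kan condition: every horn has a filler.  A horn missing the `l`-th face is encoded by a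
full family `x` whose value at `l` is disregarded. -/
class IsKan : Prop where
  horn_one (l : Fin 2) (x : Fin 2 → X.obj 0) :
    ∃ w : X.obj 1, ∀ j, j ≠ l → X.d j w = x j
  horn {n : ℕ} (l : Fin (n + 3)) (x : Fin (n + 3) → X.obj (n + 1))
    (hx : ∀ i j : Fin (n + 2), i ≤ j → i.castSucc ≠ l → j.succ ≠ l →
      X.d i (x j.succ) = X.d j (x i.castSucc)) :
    ∃ w : X.obj (n + 2), ∀ j, j ≠ l → X.d j w = x j

variable {X}

/-- The degenerate `n`-simplex on the vertex `x`. -/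
def pt (x : X.obj 0) : (n : ℕ) → X.obj n
  | 0 => x
  | n + 1 => X.s 0 (pt x n)

theorem d_pt (x : X.obj 0) : ∀ (n : ℕ) (j : Fin (n + 2)), X.d j (pt x (n + 1)) = pt x n
  | 0, j => by
    rcases Fin.eq_zero_or_eq_succ j with rfl | ⟨j, rfl⟩
    · exact X.d_s_self 0 _
    · obtain rfl : j = 0 := Subsingleton.elim _ _
      exact X.d_s_succ 0 _
  | n + 1, j => by
    rcases Fin.eq_zero_or_eq_succ j with rfl | ⟨j, rfl⟩
    · exact X.d_s_self 0 _
    · rcases Fin.eq_zero_or_eq_succ j with rfl | ⟨j, rfl⟩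
      · exact X.d_s_succ 0 _
      · have := X.d_s_of_gt j.succ 0 (by simp) (pt x (n + 1))
        rw [d_pt x n] at this
        exact this

theorem s_pt (x : X.obj 0) : ∀ (n : ℕ) (i : Fin (n + 1)), X.s i (pt x n) = pt x (n + 1)
  | 0, i => by
    obtain rfl : i = 0 := Fin.fin_one_eq_zero i
    rfl
  | n + 1, i => by
    rcases Fin.eq_zero_or_eq_succ i with rfl | ⟨i, rfl⟩
    · rfl
    · have := X.s_s 0 i (Fin.zero_le _) (pt x n)
      rw [s_pt x n i] at this
      exact this.symm

/-- The `(n + 1)`-simplices all of whose faces are degenerate on `x`. -/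
def Sphere (n : ℕ) (x : X.obj 0) : Type u :=
  {y : X.obj (n + 1) // ∀ j, X.d j y = pt x n}

/-- The constant sphere. -/
def Sphere.one (n : ℕ) (x : X.obj 0) : Sphere n x := ⟨pt x (n + 1), d_pt x n⟩

/-- The tuple `(x, …, x, a, b, c)` of length `n + 3`. -/
def tuple {n : ℕ} {x : X.obj 0} (a b c : Sphere n x) (j : Fin (n + 3)) : X.obj (n + 1) :=
  if j.val < n then pt x (n + 1) else
    if j.val = n then a.1 else if j.val = n + 1 then b.1 else c.1

/-- `Tri a b c` : there is an `(n + 2)`-simplex with boundary `(x, …, x, a, b, c)`. -/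
def Tri {n : ℕ} {x : X.obj 0} (a b c : Sphere n x) : Prop :=
  ∃ w : X.obj (n + 2), ∀ j, X.d j w = tuple a b c j

/-- `y ∼ z` : there is a simplex with boundary `(x, …, x, y, z)`. -/
def Sphere.Rel {n : ℕ} {x : X.obj 0} (y z : Sphere n x) : Prop :=
  Tri (Sphere.one n x) y z

variable (X) in
/-- `X.HomotopyGroup n x` is the homotopy group `π_{n+1}(X, x)`: the quotient of the set of
`(n + 1)`-simplices with all faces equal to `x` by the relation `∼`. -/
def HomotopyGroup (n : ℕ) (x : X.obj 0) : Type u :=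
  Quot (Sphere.Rel : Sphere n x → Sphere n x → Prop)

/-- The class of a sphere. -/
def HomotopyGroup.mk {n : ℕ} {x : X.obj 0} (y : Sphere n x) : X.HomotopyGroup n x := Quot.mk _ y

theorem Tri.face {n : ℕ} {x : X.obj 0} (y : Fin (n + 4) → Fin (n + 3) → X.obj (n + 1))
    [X.IsKan]
    (hy : ∀ i j : Fin (n + 3), i ≤ j → y j.succ i = y i.castSucc j) (l : Fin (n + 4))
    (h : ∀ k, k ≠ l → ∃ w : X.obj (n + 2), ∀ j, X.d j w = y k j) :
    ∃ w : X.obj (n + 2), ∀ j, X.d j w = y l j := by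
  classical
  have h' : ∀ k, ∃ w : X.obj (n + 2), k ≠ l → ∀ j, X.d j w = y k j := fun k => by
    by_cases hk : k = l
    · exact ⟨pt x _, fun h => (h hk).elim⟩
    · obtain ⟨w, hw⟩ := h k hk
      exact ⟨w, fun _ => hw⟩
  choose W hW using h'
  obtain ⟨w, hw⟩ := IsKan.horn (X := X) l W (fun i j hij hi hj => by
    rw [hW _ hj, hW _ hi, hy i j hij])
  refine ⟨X.d l w, fun j => ?_⟩
  by_cases hjl : j.castSucc < l
  · obtain ⟨l, rfl⟩ := Fin.exists_succ_eq.2 (Fin.ne_zero_of_lt hjl)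
    have hle : j ≤ l := Nat.lt_succ_iff.1 hjl
    rw [X.d_d j l hle, hw _ hjl.ne, hW _ hjl.ne, hy j l hle]
  · have hlj : l ≤ j.castSucc := not_lt.1 hjl
    have hl : l ≠ Fin.last _ := fun h => by
      subst h; exact absurd hlj (not_le.2 (Fin.castSucc_lt_last j))
    obtain ⟨l, rfl⟩ := Fin.exists_castSucc_eq.2 hl
    have hle : l ≤ j := by simpa using hlj
    have hne : j.succ ≠ l.castSucc := by
      intro h
      have := congrArg Fin.val h
      simp only [Fin.val_succ, Fin.val_castSucc] at this
      have := Fin.le_def.1 hle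
      omega
    rw [← X.d_d l j hle, hw _ hne, hW _ hne, hy l j hle]

theorem tetra_faces {α : Type u} (p a b c d e f : α) (n i j : ℕ) (h : i ≤ j) (hj : j < n + 3) :
    (if j + 1 < n then p else
      if j + 1 = n then (if i < n then p else if i = n then a else if i = n + 1 then b else d) else
      if j + 1 = n + 1 then
        (if i < n then p else if i = n then a else if i = n + 1 then c else e) else
      if j + 1 = n + 2 then
        (if i < n then p else if i = n then b else if i = n + 1 then c else f) else
        (if i < n then p else if i = n then d else if i = n + 1 then e else f)) =
    (if i < n then p else
      if i = n then (if j < n then p else if j = n then a else if j = n + 1 then b else d) else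
      if i = n + 1 then
        (if j < n then p else if j = n then a else if j = n + 1 then c else e) else
      if i = n + 2 then
        (if j < n then p else if j = n then b else if j = n + 1 then c else f) else
        (if j < n then p else if j = n then d else if j = n + 1 then e else f)) := by
  grind

/-- Three faces of a tetrahedron force the fourth. -/
theorem Tri.tetra [X.IsKan] {n : ℕ} {x : X.obj 0} (e01 e02 e03 e12 e13 e23 : Sphere n x)
    (l : Fin 4)
    (h0 : l ≠ 0 → Tri e23 e13 e12) (h1 : l ≠ 1 → Tri e23 e03 e02)
    (h2 : l ≠ 2 → Tri e13 e03 e01) (h3 : l ≠ 3 → Tri e12 e02 e01) :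
    (l = 0 → Tri e23 e13 e12) ∧ (l = 1 → Tri e23 e03 e02) ∧
    (l = 2 → Tri e13 e03 e01) ∧ (l = 3 → Tri e12 e02 e01) := by
  let y : Fin (n + 4) → Fin (n + 3) → X.obj (n + 1) := fun k j =>
    if k.val < n then pt x _ else
    if k.val = n then tuple e23 e13 e12 j else
    if k.val = n + 1 then tuple e23 e03 e02 j else
    if k.val = n + 2 then tuple e13 e03 e01 j else tuple e12 e02 e01 j
  have key := Tri.face (x := x) y (fun i j hij => tetra_faces _ _ _ _ _ _ _ _ _ _ hij j.2)
    (Fin.natAdd n l) (fun k hk => by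
      have hk' : k.val ≠ n + l.val := fun h => hk (Fin.ext (by simpa using h))
      have hkl := k.2
      have e : ∀ m : Fin 4, k.val = n + m.val → l ≠ m := by
        rintro m hm rfl; exact hk' hm
      simp only [y]
      split_ifs with c0 c1 c2 c3
      · exact ⟨pt x _, fun j => d_pt x _ j⟩
      · exact h0 (e 0 (by simpa using c1))
      · exact h1 (e 1 (by simpa using c2))
      · exact h2 (e 2 (by simpa using c3))
      · exact h3 (e 3 (by simp; omega)))
  refine ⟨?_, ?_, ?_, ?_⟩ <;> rintro rfl <;> simpa [y, Tri] using key

theorem d_s_sphere {n : ℕ} {x : X.obj 0} (a : Sphere n x) (i : Fin (n + 2)) (j : Fin (n + 3)) :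
    X.d j (X.s i a.1) =
      if j = i.castSucc ∨ j = i.succ then a.1 else pt x (n + 1) := by
  split_ifs with h
  · rcases h with rfl | rfl
    · exact X.d_s_self i _
    · exact X.d_s_succ i _
  · push Not at h
    rcases lt_or_gt_of_ne h.1 with hlt | hgt
    · obtain ⟨j, rfl⟩ := Fin.exists_castSucc_eq.2 (Fin.ne_last_of_lt hlt)
      obtain ⟨i, rfl⟩ := Fin.exists_succ_eq.2 (show i ≠ 0 by
        rintro rfl; exact absurd hlt (by simp))
      rw [X.d_s_of_le j i (Nat.lt_succ_iff.1 hlt), a.2, s_pt]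
    · obtain ⟨j, rfl⟩ := Fin.exists_succ_eq.2 (Fin.ne_zero_of_lt hgt)
      have h2 : i ≠ j := fun e => h.2 (by rw [e])
      have h3 : i < j := lt_of_le_of_ne (Nat.lt_succ_iff.1 hgt) h2
      obtain ⟨i, rfl⟩ := Fin.exists_castSucc_eq.2 (Fin.ne_last_of_lt h3)
      rw [X.d_s_of_gt j i h3, a.2, s_pt]

theorem tri_one_self {n : ℕ} {x : X.obj 0} (a : Sphere n x) : Tri (Sphere.one n x) a a := by
  refine ⟨X.s (Fin.last _) a.1, fun j => ?_⟩
  rw [d_s_sphere]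
  have := j.2
  simp only [tuple, Sphere.one, Fin.ext_iff, Fin.val_castSucc, Fin.val_succ, Fin.val_last]
  split_ifs <;> first | rfl | omega

theorem tri_self_one {n : ℕ} {x : X.obj 0} (a : Sphere n x) : Tri a a (Sphere.one n x) := by
  refine ⟨X.s (Fin.last _).castSucc a.1, fun j => ?_⟩
  rw [d_s_sphere]
  have := j.2
  simp only [tuple, Sphere.one, Fin.ext_iff, Fin.val_castSucc, Fin.val_succ, Fin.val_last]
  split_ifs <;> first | rfl | omega

section Kan

variable [X.IsKan] {n : ℕ} {x : X.obj 0}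

theorem exists_tri (l : Fin 3) (a b c : Sphere n x) :
    ∃ e : Sphere n x, Tri (if l = 0 then e else a) (if l = 1 then e else b)
      (if l = 2 then e else c) := by
  have hT : ∀ j i, X.d i (tuple a b c j) = pt x n := fun j i => by
    unfold tuple
    split_ifs
    exacts [d_pt x _ i, a.2 i, b.2 i, c.2 i]
  obtain ⟨w, hw⟩ := IsKan.horn (X := X) (Fin.natAdd n l) (tuple a b c)
    (fun i j _ _ _ => by rw [hT, hT])
  refine ⟨⟨X.d (Fin.natAdd n l) w, fun j => ?_⟩, w, fun j => ?_⟩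
  · generalize (Fin.natAdd n l) = l at hw
    by_cases hjl : j.castSucc < l
    · obtain ⟨l, rfl⟩ := Fin.exists_succ_eq.2 (Fin.ne_zero_of_lt hjl)
      have hle : j ≤ l := Nat.lt_succ_iff.1 hjl
      rw [X.d_d j l hle, hw _ hjl.ne, hT]
    · have hlj : l ≤ j.castSucc := not_lt.1 hjl
      have hl : l ≠ Fin.last _ := fun h => by
        subst h; exact absurd hlj (not_le.2 (Fin.castSucc_lt_last j))
      obtain ⟨l, rfl⟩ := Fin.exists_castSucc_eq.2 hl
      have hle : l ≤ j := by simpa using hlj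
      have hne : j.succ ≠ l.castSucc := by
        intro h
        have := congrArg Fin.val h
        simp only [Fin.val_succ, Fin.val_castSucc] at this
        have := Fin.le_def.1 hle
        omega
      rw [← X.d_d l j hle, hw _ hne, hT]
  · by_cases hj : j = Fin.natAdd n l
    · subst hj
      fin_cases l <;> simp [tuple]
    · rw [hw j hj]
      have hj' : j.val ≠ n + l.val := fun h => hj (Fin.ext (by simpa using h))
      have := j.2
      unfold tuple
      fin_cases l <;> simp at hj' ⊢ <;> split_ifs <;> first | rfl | omega

/-- The product of `a` and `c` is the class of `d_{n+1} w` for a filler `w` of the horn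
`(x, …, x, a, ∅, c)`. -/
noncomputable def Sphere.mul (a c : Sphere n x) : Sphere n x := (exists_tri 1 a a c).choose

theorem tri_mul (a c : Sphere n x) : Tri a (a.mul c) c := (exists_tri 1 a a c).choose_spec

theorem exists_tri_left (b c : Sphere n x) : ∃ a, Tri a b c := exists_tri 0 b b c

theorem rel_euclid {a b c : Sphere n x} (h1 : a.Rel c) (h2 : b.Rel c) : b.Rel a :=
  (Tri.tetra c a b (Sphere.one n x) (Sphere.one n x) (Sphere.one n x) 1
    (fun _ => tri_one_self _) (fun h => (h rfl).elim) (fun _ => h2) (fun _ => h1)).2.1 rfl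

theorem rel_equivalence : Equivalence (Sphere.Rel : Sphere n x → Sphere n x → Prop) where
  refl := tri_one_self
  symm h := rel_euclid h (tri_one_self _)
  trans h1 h2 := rel_euclid (rel_euclid h2 (tri_one_self _)) h1

theorem tri_rel {a a' b b' c c' : Sphere n x} (ha : a.Rel a') (hc : c.Rel c')
    (h : Tri a b c) (h' : Tri a' b' c') : b.Rel b' :=
  have h1 : Tri a b c' :=
    (Tri.tetra c' c b (Sphere.one n x) a a 2 (fun _ => tri_self_one a) (fun _ => h)
      (fun h => (h rfl).elim) (fun _ => hc)).2.2.1 rfl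
  (Tri.tetra c' b' b a' a (Sphere.one n x) 1 (fun _ => ha) (fun h => (h rfl).elim)
    (fun _ => h1) (fun _ => h')).2.1 rfl

theorem rel_mul_of_tri {a b c : Sphere n x} (h : Tri a b c) : (a.mul c).Rel b :=
  tri_rel (tri_one_self _) (tri_one_self _) (tri_mul a c) h

theorem mul_assoc_rel (a b c : Sphere n x) : ((a.mul b).mul c).Rel (a.mul (b.mul c)) :=
  rel_mul_of_tri ((Tri.tetra c (b.mul c) (a.mul (b.mul c)) b (a.mul b) a 2
    (fun _ => tri_mul a b) (fun _ => tri_mul _ _) (fun h => (h rfl).elim)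
    (fun _ => tri_mul b c)).2.2.1 rfl)

/-- The group structure on `π_{n+1}(X, x)`: `[a][c] = [d_{n+1} w]` for any simplex `w` whose faces
other than the `(n + 1)`-st are `(x, …, x, a, ∅, c)`. -/
noncomputable instance : Mul (HomotopyGroup X n x) where
  mul := Quot.map₂ Sphere.mul
    (fun _ _ _ h => tri_rel (tri_one_self _) h (tri_mul _ _) (tri_mul _ _))
    (fun _ _ _ h => tri_rel h (tri_one_self _) (tri_mul _ _) (tri_mul _ _))

theorem mk_mul_mk {a b c : Sphere n x} (h : Tri a b c) :
    HomotopyGroup.mk a * HomotopyGroup.mk c = HomotopyGroup.mk b :=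
  Quot.sound (rel_mul_of_tri h)

theorem exists_mul_eq_one (q : HomotopyGroup X n x) :
    ∃ r, r * q = HomotopyGroup.mk (Sphere.one n x) := by
  obtain ⟨c⟩ := q
  obtain ⟨a, ha⟩ := exists_tri_left (Sphere.one n x) c
  exact ⟨HomotopyGroup.mk a, mk_mul_mk ha⟩

noncomputable instance : Group (HomotopyGroup X n x) :=
  letI : One (HomotopyGroup X n x) := ⟨HomotopyGroup.mk (Sphere.one n x)⟩
  letI : Inv (HomotopyGroup X n x) := ⟨fun q => (exists_mul_eq_one q).choose⟩
  Group.ofLeftAxioms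
    (by rintro ⟨a⟩ ⟨b⟩ ⟨c⟩; exact Quot.sound (mul_assoc_rel a b c))
    (by rintro ⟨a⟩; exact mk_mul_mk (tri_one_self a))
    (fun q => (exists_mul_eq_one q).choose_spec)

end Kan

/-- `X` is a `k`-type: it is a Kan complex and `π_m(X, x)` is trivial for all `m > k`
and all vertices `x`. -/
def IsType (X : SimpSet.{u}) (k : ℕ) : Prop :=
  X.IsKan ∧ ∀ n : ℕ, k < n + 1 → ∀ x : X.obj 0, Subsingleton (X.HomotopyGroup n x)

end SimpSet

/-! ### Crossed monoids, crossed modules and their nerve -/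

/-- A crossed monoid over a category `C`: a contravariant functor `A` from `C` to monoids, with
`act α a` being `a ^ α`, and homomorphisms `∂ t : A t → C(t, t)`.  In `End t` the product is
`f * g = g ≫ f`.  If `C` is a groupoid and every `A t` is a group, this is a crossed module. -/
structure CrossedMonoid (C : Type u) [Category.{v} C] (A : C → Type w) [∀ t, Monoid (A t)] where
  act {s t : C} (α : s ⟶ t) : A t →* A s
  act_id (t : C) (a : A t) : act (𝟙 t) a = a
  act_comp {r s t : C} (β : r ⟶ s) (α : s ⟶ t) (a : A t) : act (β ≫ α) a = act β (act α a)
  bd (t : C) : A t →* End t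
  bd_act {s t : C} (α : s ⟶ t) (a : A t) : bd s (act α a) ≫ α = α ≫ bd t a
  peiffer {t : C} (a b : A t) : a * b = b * act (bd t b) a

/-- Upper triangular `n × n` matrices with `x₀ = x`, presented row by row: the matrix
`cons g r M` has first row `(g, r 0, …, r (n - 1))` with `g = m₁₁ : x₁ ⟶ x₀` and
`r k = m_{1, k + 2} ∈ A(x₁)`, and `M` (with objects `x₁, x₂, …`) consists of the other rows. -/
inductive TriMat {C : Type u} [Category.{v} C] (A : C → Type w) : ℕ → C → Type (max u v w)
  | nil (x : C) : TriMat A 0 x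
  | cons {n : ℕ} {x y : C} (g : y ⟶ x) (r : Fin n → A y) (M : TriMat A n y) : TriMat A (n + 1) x

namespace CrossedMonoid

open TriMat

variable {C : Type u} [Category.{v} C] {A : C → Type w} [∀ t, Monoid (A t)]
  (X : CrossedMonoid C A)

/-- For consecutive rows `(g, r)` and `(h, r')` of a matrix, the entries off the diagonal
of the row replacing both of them:
`m_{j, k + 1} ^ η_{j + 1, k} * m_{j + 1, k + 1}`, where
`η_{j + 1, k} = m_{j + 1, j + 1} ∂(m_{j + 1, j + 2} ⋯ m_{j + 1, k})`. -/
def mergeRow {n : ℕ} {y z : C} (h : z ⟶ y) (r : Fin (n + 1) → A y) (r' : Fin n → A z)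
    (i : Fin n) : A z :=
  X.act (X.bd z (Fin.partialProd r' i.castSucc) ≫ h) (r i.succ) * r' i

/-- `X.face j` is the face map `d_{j + 1}`, which preserves `x₀`.  For `j = 0` it merges the first
two rows (or removes the only row if there is just one).  For `j > 0` it multiplies the entries of
the first row in the columns `j + 1` and `j + 2` (or removes the last column if it is the
column `j + 1`), and acts on the other rows as `d_j`. -/
def face : {n : ℕ} → {x : C} → Fin (n + 1) → TriMat A (n + 1) x → TriMat A n x
  | 0, x, _, _ => nil x
  | _ + 1, _, j, cons g r M =>
    Fin.cases
      (match M with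
        | cons h r' M' => cons (h ≫ X.bd _ (r 0) ≫ g) (X.mergeRow h r r') M')
      (fun j => cons g (Fin.contractNth j (· * ·) r) (face j M)) j

/-- `degen j` is the degeneracy map `s_j`.  For `j = 0` it adds a new first row `(1, e, …, e)`.
For `j > 0` it inserts `e` into the first row at the column `j + 1`,
and acts on the other rows as `s_{j - 1}`. -/
def degen : {n : ℕ} → {x : C} → Fin (n + 1) → TriMat A n x → TriMat A (n + 1) x
  | 0, x, _, M => cons (𝟙 x) (fun _ => 1) M
  | _ + 1, x, j, cons g r M =>
    Fin.cases (cons (𝟙 x) (fun _ => 1) (cons g r M))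
      (fun j => cons g (Fin.insertNth j 1 r) (degen j M)) j

/-- The matrix without its first row, together with the object `x₁`. -/
def tail {n : ℕ} {x : C} : TriMat A (n + 1) x → Σ y : C, TriMat A n y
  | cons (y := y) _ _ M => ⟨y, M⟩

variable (A) in
/-- The `n`-simplices of the nerve. -/
abbrev NerveObj (n : ℕ) : Type (max u v w) := Σ x : C, TriMat A n x

/-- The face maps of the nerve; `d₀` removes the first row. -/
def nerveD {n : ℕ} (j : Fin (n + 2)) (M : NerveObj A (n + 1)) : NerveObj A n :=
  Fin.cases (tail M.2) (fun j => ⟨M.1, X.face j M.2⟩) j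

/-- The degeneracy maps of the nerve. -/
def nerveS {n : ℕ} (j : Fin (n + 1)) (M : NerveObj A n) : NerveObj A (n + 1) :=
  ⟨M.1, degen j M.2⟩


theorem degen_zero {n : ℕ} {x : C} (M : TriMat A n x) :
    degen 0 M = cons (𝟙 x) (fun _ => 1) M := by
  cases M <;> simp [degen]

theorem exists_nat_fun {B : Type w} [Monoid B] {n : ℕ} (r : Fin n → B) :
    ∃ R : ℕ → B, r = fun k => R k.val :=
  ⟨fun k => if h : k < n then r ⟨k, h⟩ else 1, by funext k; simp⟩

/-- Insertion of `1` at the place `j`, for functions on `ℕ`. -/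
def insFun {B : Type w} [Monoid B] (j : ℕ) (R : ℕ → B) (k : ℕ) : B :=
  if k < j then R k else if k = j then 1 else R (k - 1)

/-- Multiplication of the entries at the places `j` and `j + 1`, for functions on `ℕ`. -/
def conFun {B : Type w} [Monoid B] (j : ℕ) (R : ℕ → B) (k : ℕ) : B :=
  if k < j then R k else if k = j then R k * R (k + 1) else R (k + 1)

theorem insertNth_nat {B : Type w} [Monoid B] {n : ℕ} (R : ℕ → B) (j : Fin (n + 1)) :
    (Fin.insertNth j 1 (fun k : Fin n => R k.val) : Fin (n + 1) → B) =
      fun k => insFun j.val R k.val := by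
  rw [Fin.insertNth_eq_iff]
  refine ⟨by simp [insFun], ?_⟩
  funext k
  simp only [Fin.removeNth, Fin.succAbove, Fin.lt_def, insFun]
  split_ifs <;> simp at * <;> omega

theorem contractNth_nat {B : Type w} [Monoid B] {n : ℕ} (R : ℕ → B) (j : Fin (n + 1)) :
    (Fin.contractNth j (· * ·) (fun k : Fin (n + 1) => R k.val) : Fin n → B) =
      fun k => conFun j.val R k.val := rfl

theorem contractNth_insertNth_of_lt {B : Type w} [Monoid B] {m : ℕ} (r : Fin (m + 1) → B)
    (i j : Fin (m + 1)) (h : i < j) :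
    Fin.contractNth i.castSucc (· * ·) (Fin.insertNth j.succ 1 r : Fin (m + 2) → B) =
      Fin.insertNth j 1 (Fin.contractNth i (· * ·) r) := by
  obtain ⟨R, rfl⟩ := exists_nat_fun r
  have h := Fin.lt_def.1 h
  rw [insertNth_nat, contractNth_nat, contractNth_nat, insertNth_nat]
  funext k
  simp only [Fin.val_castSucc, Fin.val_succ, insFun, conFun]
  grind

theorem contractNth_insertNth_self {B : Type w} [Monoid B] {m : ℕ} (r : Fin m → B)
    (j : Fin (m + 1)) :
    Fin.contractNth j (· * ·) (Fin.insertNth j 1 r : Fin (m + 1) → B) = r := by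
  obtain ⟨R, rfl⟩ := exists_nat_fun r
  rw [insertNth_nat, contractNth_nat]
  funext k
  simp only [insFun, conFun]
  grind

theorem contractNth_insertNth_succ {B : Type w} [Monoid B] {m : ℕ} (r : Fin m → B)
    (j : Fin m) :
    Fin.contractNth j.castSucc (· * ·) (Fin.insertNth j.succ 1 r : Fin (m + 1) → B) = r := by
  obtain ⟨R, rfl⟩ := exists_nat_fun r
  rw [insertNth_nat, contractNth_nat]
  funext k
  simp only [Fin.val_castSucc, Fin.val_succ, insFun, conFun]
  grind

theorem contractNth_insertNth_of_gt {B : Type w} [Monoid B] {m : ℕ} (r : Fin (m + 1) → B)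
    (i j : Fin (m + 1)) (h : j ≤ i) :
    Fin.contractNth i.succ (· * ·) (Fin.insertNth j.castSucc 1 r : Fin (m + 2) → B) =
      Fin.insertNth j 1 (Fin.contractNth i (· * ·) r) := by
  obtain ⟨R, rfl⟩ := exists_nat_fun r
  have h := Fin.le_def.1 h
  rw [insertNth_nat, contractNth_nat, contractNth_nat, insertNth_nat]
  funext k
  simp only [Fin.val_castSucc, Fin.val_succ, insFun, conFun]
  grind

theorem insertNth_insertNth {B : Type w} [Monoid B] {m : ℕ} (r : Fin m → B)
    (i j : Fin (m + 1)) (h : i ≤ j) :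
    (Fin.insertNth i.castSucc 1 (Fin.insertNth j 1 r : Fin (m + 1) → B) : Fin (m + 2) → B) =
      Fin.insertNth j.succ 1 (Fin.insertNth i 1 r : Fin (m + 1) → B) := by
  obtain ⟨R, rfl⟩ := exists_nat_fun r
  have h := Fin.le_def.1 h
  rw [insertNth_nat, insertNth_nat, insertNth_nat, insertNth_nat]
  funext k
  simp only [Fin.val_castSucc, Fin.val_succ, insFun]
  grind

theorem partialProd_insertNth {B : Type w} [Monoid B] {n : ℕ} (R : ℕ → B) (j : Fin (n + 1))
    (i : Fin (n + 2)) (i' : Fin (n + 1)) (h : i'.val = if i.val ≤ j.val then i.val else i.val - 1) :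
    Fin.partialProd (Fin.insertNth j 1 (fun k : Fin n => R k.val) : Fin (n + 1) → B) i =
      Fin.partialProd (fun k : Fin n => R k.val) i' := by
  rw [insertNth_nat]
  induction i using Fin.induction generalizing i' with
  | zero =>
    obtain rfl : i' = 0 := Fin.ext (by simpa using h)
    simp
  | succ i ih =>
    rw [Fin.partialProd_succ]
    rcases lt_trichotomy i.val j.val with hij | hij | hij
    · obtain ⟨i'', rfl⟩ := Fin.exists_succ_eq.2 (show i' ≠ 0 by
        rintro rfl; simp at h; grind)
      have e : i''.val = i.val := by simp at h; grind
      rw [ih i''.castSucc (by simp; grind), Fin.partialProd_succ]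
      simp [insFun, hij, e]
    · rw [ih i' (by simp at h ⊢; grind)]
      simp [insFun, hij]
    · obtain ⟨i'', rfl⟩ := Fin.exists_succ_eq.2 (show i' ≠ 0 by
        rintro rfl; simp at h; grind)
      have e : i''.val = i.val - 1 := by simp at h; grind
      rw [ih i''.castSucc (by simp; grind), Fin.partialProd_succ]
      simp [insFun, hij.not_gt, hij.ne', e]

theorem insertNth_succ_zero {B : Type w} [Monoid B] {n : ℕ} (r : Fin (n + 1) → B)
    (j : Fin (n + 1)) : (Fin.insertNth j.succ 1 r : Fin (n + 2) → B) 0 = r 0 := by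
  obtain ⟨R, rfl⟩ := exists_nat_fun r
  rw [insertNth_nat]
  simp [insFun]

theorem partialProd_one {B : Type w} [Monoid B] {n : ℕ} (i : Fin (n + 1)) :
    Fin.partialProd (fun _ : Fin n => (1 : B)) i = 1 := by
  simp [Fin.partialProd]

theorem merge_insert {n : ℕ} {y z : C} (h : z ⟶ y) (r : Fin (n + 1) → A y) (r' : Fin n → A z)
    (j : Fin (n + 1)) :
    X.mergeRow h (Fin.insertNth j.succ 1 r : Fin (n + 2) → A y) (Fin.insertNth j 1 r') =
      (Fin.insertNth j 1 (X.mergeRow h r r') : Fin (n + 1) → A z) := by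
  obtain ⟨R, rfl⟩ := exists_nat_fun r
  obtain ⟨R', rfl⟩ := exists_nat_fun r'
  symm
  rw [Fin.insertNth_eq_iff]
  constructor
  · rw [mergeRow]
    simp [insertNth_nat, insFun]
  · funext i
    rw [Fin.removeNth, mergeRow, mergeRow,
      partialProd_insertNth R' j _ i.castSucc (by
        simp only [Fin.val_castSucc, Fin.succAbove, Fin.lt_def]
        split_ifs <;> simp at * <;> omega), Fin.insertNth_apply_succAbove,
        ← Fin.succ_succAbove_succ, Fin.insertNth_apply_succAbove]

theorem contractNth_contractNth {B : Type w} [Monoid B] {n : ℕ} (i j : Fin (n + 1)) (h : i ≤ j)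
    (r : Fin (n + 2) → B) :
    Fin.contractNth i (· * ·) (Fin.contractNth j.succ (· * ·) r) =
      Fin.contractNth j (· * ·) (Fin.contractNth i.castSucc (· * ·) r) := by
  have h := Fin.le_def.1 h
  funext k
  simp only [Fin.contractNth, Fin.val_castSucc, Fin.val_succ, Fin.succ_castSucc]
  split_ifs <;> first | rfl | omega | exact mul_assoc _ _ _ | exact (mul_assoc _ _ _).symm

theorem bd_partialProd_mergeRow {n : ℕ} {y z : C} (h : z ⟶ y) (r : Fin (n + 1) → A y)
    (r' : Fin n → A z) (i : Fin (n + 1)) :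
    Fin.partialProd (X.mergeRow h r r') i =
      X.act h (Fin.partialProd (Fin.tail r) i) * Fin.partialProd r' i := by
  induction i using Fin.induction with
  | zero => simp
  | succ i ih =>
    rw [Fin.partialProd_succ, ih, Fin.partialProd_succ, Fin.partialProd_succ, mergeRow,
      X.act_comp, map_mul, mul_assoc, mul_assoc, ← mul_assoc _ _ (r' i), ← X.peiffer, mul_assoc]
    rfl

theorem merge_merge {m : ℕ} {y z t : C} (h : z ⟶ y) (k : t ⟶ z) (r : Fin (m + 2) → A y)
    (r' : Fin (m + 1) → A z) (r'' : Fin m → A t) :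
    X.mergeRow (k ≫ X.bd z (r' 0) ≫ h) (Fin.contractNth 0 (· * ·) r) (X.mergeRow k r' r'') =
      X.mergeRow k (X.mergeRow h r r') r'' := by
  funext i
  have e : X.bd t (Fin.partialProd (X.mergeRow k r' r'') i.castSucc) ≫ k ≫ X.bd z (r' 0) ≫ h =
      (X.bd t (Fin.partialProd r'' i.castSucc) ≫ k) ≫
        X.bd z (Fin.partialProd r' i.castSucc.succ) ≫ h := by
    rw [bd_partialProd_mergeRow, map_mul, End.mul_def, Fin.partialProd_succ', map_mul,
      End.mul_def]
    simp only [Category.assoc]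
    rw [← Category.assoc (X.bd t (X.act k _)), X.bd_act]
    simp only [Category.assoc]
  have e2 : Fin.contractNth 0 (· * ·) r i.succ = r i.succ.succ :=
    Fin.contractNth_apply_of_gt _ _ _ _ (by simp)
  rw [mergeRow, e, X.act_comp, e2, mergeRow, mergeRow, mergeRow, map_mul, mul_assoc]
  rfl

theorem merge_contract {m : ℕ} {y z : C} (h : z ⟶ y) (r : Fin (m + 2) → A y)
    (r' : Fin (m + 1) → A z) (j : Fin (m + 1)) :
    X.mergeRow h (Fin.contractNth j.succ (· * ·) r) (Fin.contractNth j (· * ·) r') =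
      Fin.contractNth j (· * ·) (X.mergeRow h r r') := by
  funext i
  rw [mergeRow, Fin.partialProd_contractNth]
  rcases lt_trichotomy i.val j.val with hij | hij | hij
  · rw [Fin.contractNth_apply_of_lt _ _ _ _ hij, Fin.contractNth_apply_of_lt _ _ _ _ hij,
      Fin.contractNth_apply_of_lt _ _ _ _ (by simpa using hij), mergeRow, Function.comp_apply,
      Fin.succAbove_of_castSucc_lt _ _ (by simp [Fin.lt_def]; omega), Fin.succ_castSucc]
  · rw [Fin.contractNth_apply_of_eq _ _ _ _ hij, Fin.contractNth_apply_of_eq _ _ _ _ hij,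
      Fin.contractNth_apply_of_eq _ _ _ _ (by simpa using hij), mergeRow, mergeRow,
      Function.comp_apply,
      Fin.succAbove_of_castSucc_lt _ _ (by simp [Fin.lt_def]; omega), Fin.succ_castSucc,
      ← Fin.succ_castSucc, Fin.partialProd_succ, map_mul, map_mul, End.mul_def,
      Category.assoc, X.act_comp _ (_ ≫ _) (r _)]
    simp only [mul_assoc]
    rw [← mul_assoc _ (r' i.castSucc), X.peiffer _ (r' i.castSucc), mul_assoc]
  · rw [Fin.contractNth_apply_of_gt _ _ _ _ hij, Fin.contractNth_apply_of_gt _ _ _ _ hij,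
      Fin.contractNth_apply_of_gt _ _ _ _ (by simpa using hij), mergeRow, Function.comp_apply,
      Fin.succAbove_of_le_castSucc _ _ (by simp [Fin.le_def]; omega), Fin.succ_castSucc]

theorem face_zero_cons {n : ℕ} {x y z : C} (g : y ⟶ x) (r : Fin (n + 1) → A y) (h : z ⟶ y)
    (r' : Fin n → A z) (M : TriMat A n z) :
    X.face 0 (cons g r (cons h r' M)) =
      cons (h ≫ X.bd _ (r 0) ≫ g) (X.mergeRow h r r') M := rfl

theorem face_succ_cons {n : ℕ} {x y : C} (j : Fin (n + 1)) (g : y ⟶ x) (r : Fin (n + 1) → A y)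
    (M : TriMat A (n + 1) y) :
    X.face j.succ (cons g r M) = cons g (Fin.contractNth j (· * ·) r) (X.face j M) := by
  cases M; rfl

theorem degen_succ_cons {n : ℕ} {x y : C} (j : Fin (n + 1)) (g : y ⟶ x) (r : Fin n → A y)
    (M : TriMat A n y) :
    degen j.succ (cons g r M) = cons g (Fin.insertNth j 1 r) (degen j M) := rfl

theorem face_face : ∀ {n : ℕ} {x : C} (i j : Fin (n + 1)) (_ : i ≤ j) (M : TriMat A (n + 2) x),
    X.face i (X.face j.succ M) = X.face j (X.face i.castSucc M)
  | 0, _, _, _, _, _ => rfl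
  | n + 1, x, i, j, hij, cons g r M => by
    rcases Fin.eq_zero_or_eq_succ i with rfl | ⟨i, rfl⟩
    · obtain _ | ⟨h, r', M⟩ := M
      rcases Fin.eq_zero_or_eq_succ j with rfl | ⟨j, rfl⟩
      · cases M with
        | cons k r'' M =>
          rw [face_succ_cons, face_zero_cons, face_zero_cons, Fin.castSucc_zero, face_zero_cons,
            face_zero_cons, merge_merge]
          congr 1
          rw [Fin.contractNth_apply_of_eq _ _ _ _ rfl, mergeRow, map_mul, map_mul]
          simp only [End.mul_def, Category.assoc, Fin.castSucc_zero, Fin.partialProd_zero, map_one,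
            End.one_def, Category.id_comp]
          rw [← Category.assoc (X.bd _ (X.act h _)), X.bd_act, Category.assoc]
      · rw [face_succ_cons, face_succ_cons, face_zero_cons, Fin.castSucc_zero, face_zero_cons,
            face_succ_cons, merge_contract, Fin.contractNth_apply_of_lt _ _ _ _ (by simp)]
        rfl
    · rcases Fin.eq_zero_or_eq_succ j with rfl | ⟨j, rfl⟩
      · simp at hij
      · have hij : i ≤ j := by simpa using hij
        rw [face_succ_cons, ← Fin.succ_castSucc, face_succ_cons, face_succ_cons, face_succ_cons,
          face_face i j hij, contractNth_contractNth i j hij]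

theorem face_degen_of_le : ∀ {n : ℕ} {x : C} (i : Fin (n + 1)) (j : Fin (n + 1)) (_ : i < j)
    (M : TriMat A (n + 1) x),
    X.face i.castSucc (degen j.succ M) = degen j (X.face i M)
  | 0, _, i, j, hij, _ => by
    have := Fin.lt_def.1 hij
    omega
  | n + 1, x, i, j, hij, cons g r M => by
    obtain ⟨j, rfl⟩ := Fin.exists_succ_eq.2 (Fin.ne_zero_of_lt hij)
    rcases Fin.eq_zero_or_eq_succ i with rfl | ⟨i, rfl⟩
    · cases M with
      | cons h r' M =>
        rw [degen_succ_cons, degen_succ_cons, Fin.castSucc_zero, face_zero_cons, face_zero_cons,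
          degen_succ_cons, merge_insert, insertNth_succ_zero]
    · have hij : i < j := by simpa using hij
      rw [degen_succ_cons, ← Fin.succ_castSucc, face_succ_cons, face_succ_cons,
        degen_succ_cons, face_degen_of_le i j hij, contractNth_insertNth_of_lt _ _ _ hij]

theorem face_degen_self : ∀ {n : ℕ} {x : C} (j : Fin (n + 1)) (M : TriMat A n x),
    X.face j (degen j M) = M
  | 0, _, _, nil x => rfl
  | n + 1, x, j, cons g r M => by
    rcases Fin.eq_zero_or_eq_succ j with rfl | ⟨j, rfl⟩
    · rw [degen_zero, face_zero_cons]
      congr 1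
      · simp
      · funext i
        simp [mergeRow]
    · rw [degen_succ_cons, face_succ_cons, face_degen_self j M, contractNth_insertNth_self]

theorem face_degen_succ : ∀ {n : ℕ} {x : C} (j : Fin n) (M : TriMat A n x),
    X.face j.castSucc (degen j.succ M) = M
  | n + 1, x, j, cons g r M => by
    rcases Fin.eq_zero_or_eq_succ j with rfl | ⟨j, rfl⟩
    · rw [degen_succ_cons, degen_zero, Fin.castSucc_zero, face_zero_cons]
      congr 1
      · simp
      · funext i
        simp [mergeRow, partialProd_one, X.act_id]
    · cases n with
      | zero => exact j.elim0
      | succ n =>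
        rw [degen_succ_cons, ← Fin.succ_castSucc, face_succ_cons, face_degen_succ j M,
          contractNth_insertNth_succ]

theorem face_degen_of_gt : ∀ {n : ℕ} {x : C} (i : Fin (n + 1)) (j : Fin (n + 1)) (_ : j ≤ i)
    (M : TriMat A (n + 1) x),
    X.face i.succ (degen j.castSucc M) = degen j (X.face i M)
  | n, x, i, j, hij, cons g r M => by
    rcases Fin.eq_zero_or_eq_succ j with rfl | ⟨j, rfl⟩
    · rw [Fin.castSucc_zero, degen_zero, face_succ_cons, degen_zero]
      congr 1
      funext k
      simp [Fin.contractNth]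
    · cases n with
      | zero => exact j.elim0
      | succ n =>
        obtain ⟨i, rfl⟩ := Fin.exists_succ_eq.2 (show i ≠ 0 by
          rintro rfl; simp at hij)
        have hij : j ≤ i := by simpa using hij
        rw [← Fin.succ_castSucc, degen_succ_cons, face_succ_cons, face_succ_cons,
          degen_succ_cons, face_degen_of_gt i j hij, contractNth_insertNth_of_gt _ _ _ hij]

theorem degen_degen : ∀ {n : ℕ} {x : C} (i j : Fin (n + 1)) (_ : i ≤ j) (M : TriMat A n x),
    degen i.castSucc (degen j M) = degen j.succ (degen i M)
  | n, x, i, j, hij, M => by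
    rcases Fin.eq_zero_or_eq_succ i with rfl | ⟨i, rfl⟩
    · rw [Fin.castSucc_zero, degen_zero, degen_zero, degen_succ_cons]
      congr 1
      symm
      rw [Fin.insertNth_eq_iff]
      exact ⟨rfl, rfl⟩
    · obtain ⟨j, rfl⟩ := Fin.exists_succ_eq.2 (show j ≠ 0 by
          rintro rfl; simp at hij)
      have hij : i ≤ j := by simpa using hij
      cases M with
      | nil => exact i.elim0
      | cons g r M =>
        rw [← Fin.succ_castSucc, degen_succ_cons, degen_succ_cons, degen_succ_cons,
          degen_succ_cons, degen_degen i j hij, insertNth_insertNth _ _ _ hij]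

theorem tail_degen_succ {n : ℕ} {x : C} (j : Fin (n + 1)) (M : TriMat A (n + 1) x) :
    tail (degen j.succ M) = ⟨(tail M).1, degen j (tail M).2⟩ := by
  cases M; rfl

theorem tail_degen_zero {n : ℕ} {x : C} (M : TriMat A n x) :
    tail (degen 0 M) = ⟨x, M⟩ := by
  rw [degen_zero]; rfl

theorem tail_face_zero {n : ℕ} {x : C} (M : TriMat A (n + 2) x) :
    tail (X.face 0 M) = tail (tail M).2 := by
  obtain _ | ⟨g, r, _ | ⟨h, r', M⟩⟩ := M
  rfl

theorem tail_face_succ {n : ℕ} {x : C} (j : Fin (n + 1)) (M : TriMat A (n + 2) x) :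
    tail (X.face j.succ M) = ⟨(tail M).1, X.face j (tail M).2⟩ := by
  cases M; rw [face_succ_cons]; rfl

/-- The nerve of a crossed monoid. -/
def nerve : SimpSet.{max u v w} where
  obj := NerveObj A
  d := X.nerveD
  s := nerveS
  d_d i j h := by
    rintro ⟨x, M⟩
    rcases Fin.eq_zero_or_eq_succ i with rfl | ⟨i, rfl⟩
    · rcases Fin.eq_zero_or_eq_succ j with rfl | ⟨j, rfl⟩
      · exact X.tail_face_zero M
      · exact X.tail_face_succ _ M
    · rcases Fin.eq_zero_or_eq_succ j with rfl | ⟨j, rfl⟩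
      · simp at h
      · exact congrArg (Sigma.mk x) (X.face_face i j (by simpa using h) M)
  d_s_of_le i j h := by
    rintro ⟨x, M⟩
    rcases Fin.eq_zero_or_eq_succ i with rfl | ⟨i, rfl⟩
    · exact tail_degen_succ _ M
    · rcases Fin.eq_zero_or_eq_succ j with rfl | ⟨j, rfl⟩
      · simp at h
      · exact congrArg (Sigma.mk x) (X.face_degen_of_le i j.succ h M)
  d_s_self i := by
    rintro ⟨x, M⟩
    rcases Fin.eq_zero_or_eq_succ i with rfl | ⟨i, rfl⟩
    · exact tail_degen_zero M
    · exact congrArg (Sigma.mk x) (X.face_degen_succ i M)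
  d_s_succ i := by
    rintro ⟨x, M⟩
    exact congrArg (Sigma.mk x) (X.face_degen_self i M)
  d_s_of_gt i j h := by
    rintro ⟨x, M⟩
    rcases Fin.eq_zero_or_eq_succ i with rfl | ⟨i, rfl⟩
    · simp at h
    · exact congrArg (Sigma.mk x) (X.face_degen_of_gt i j (Nat.lt_succ_iff.1 h) M)
  s_s i j h := by
    rintro ⟨x, M⟩
    exact congrArg (Sigma.mk x) (degen_degen i j h M)

/-- The vertex of the nerve given by an object. -/
def vertex (t : C) : X.nerve.obj 0 := ⟨t, nil t⟩

end CrossedMonoid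

/-- In a crossed module the image of `∂ t` is normal. -/
instance CrossedMonoid.normal_range_bd {C : Type u} [Groupoid.{v} C] {A : C → Type w}
    [∀ t, Group (A t)] (X : CrossedMonoid C A) (t : C) : (X.bd t).range.Normal where
  conj_mem := by
    rintro _ ⟨a, rfl⟩ g
    refine ⟨X.act (Groupoid.inv g) a, ?_⟩
    have h := X.bd_act (Groupoid.inv g) a
    change _ = Groupoid.inv g ≫ X.bd t a ≫ g
    rw [← Category.assoc, ← h, Category.assoc, Groupoid.inv_comp, Category.comp_id]

/-! ### Rows of matrices over a crossed module -/

/-! A simplex of positive dimension is a first row `(g, r)` on top of a matrix `M`. The face d₀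
returns `M`, d₁ merges the first row into the next one, and d_{j+2} keeps `g`, contracts `r` at the
place `j` and acts on `M` as d_{j+1}. From dimension 3 on, `r` has at least two entries, and d₀, …,
d₃ become equations for `g`, `r`, `M`: d₂ and d₃ give `g` and, together, all of `r`; d₁ gives `M`
once `(g, r)` is known, and the tail of `r` once `g` and `M` are known. Merging can be undone on
either side because all entries are invertible; for the lower row this uses
`bd_partialProd_mergeRow`, a consequence of the Peiffer identity, by which partial products of a
merged row split as a product.

Hence any three of d₀, …, d₃ determine a simplex of dimension at least 3 (`nerve_ext_zero` to
`nerve_ext_three`), and any three compatible simplices are such faces of some simplex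
(`exists_nerve_zero` to `exists_nerve_three`). A horn of dimension at least 3 prescribes three of
these faces, so it has a filler of them; each remaining prescribed face has dimension at least 3 and
agrees with that of the filler, since the two share three faces. Horns of lower dimension are filled
by degenerate edges and by composition and division in the groupoid.

The same rigidity gives the homotopy groups. A sphere of dimension at least 3 is constant, and
homotopic spheres of dimension at least 2 are equal. So π₂ is the set of triangles with identity
edges, that is, with entry in Ker ∂, and one explicit 3-simplex computes the product. In dimension 1
a triangle with edges `f`, `g`, `h` exists exactly when `g = h ∂(a) f` for some `a`; this describes
π₁ as a quotient of the automorphism group, with the product reversed, which inversion corrects. -/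

theorem TriMat.cons_inj {C : Type u} [Category.{v} C] {A : C → Type w} {n : ℕ} {x y : C}
    {g g' : y ⟶ x} {r r' : Fin n → A y} {M M' : TriMat A n y}
    (h : cons g r M = cons g' r' M') : g = g' ∧ r = r' ∧ M = M' := by
  simpa using h

namespace CrossedMonoid

open TriMat

variable {C : Type u} [Groupoid.{v} C] {A : C → Type w} [∀ t, Group (A t)]
  (X : CrossedMonoid C A)

theorem act_inv_act {s t : C} (α : s ⟶ t) (a : A t) : X.act (Groupoid.inv α) (X.act α a) = a := by
  rw [← X.act_comp, Groupoid.inv_comp, X.act_id]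

theorem act_act_inv {s t : C} (α : s ⟶ t) (a : A s) : X.act α (X.act (Groupoid.inv α) a) = a := by
  rw [← X.act_comp, Groupoid.comp_inv, X.act_id]

theorem act_injective {s t : C} (α : s ⟶ t) : Function.Injective (X.act α) :=
  Function.LeftInverse.injective (X.act_inv_act α)

theorem contractNth_zero_zero {B : Type w} [Monoid B] {n : ℕ} (r : Fin (n + 2) → B) :
    Fin.contractNth 0 (· * ·) r 0 = r 0 * r 1 :=
  Fin.contractNth_apply_of_eq _ _ _ _ rfl

theorem contractNth_succ_zero {B : Type w} [Monoid B] {n : ℕ} (j : Fin (n + 1))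
    (r : Fin (n + 2) → B) : Fin.contractNth j.succ (· * ·) r 0 = r 0 :=
  Fin.contractNth_apply_of_lt _ _ _ _ (by simp)

theorem contractNth_zero_succ {B : Type w} [Monoid B] {n : ℕ} (r : Fin (n + 2) → B) (i : Fin n) :
    Fin.contractNth 0 (· * ·) r i.succ = r i.succ.succ :=
  Fin.contractNth_apply_of_gt _ _ _ _ (by simp)

/-- A row is determined by its contractions at the first two places. -/
theorem contractNth_injective {B : Type w} [Group B] {n : ℕ} {r q : Fin (n + 2) → B}
    (h0 : Fin.contractNth 0 (· * ·) r = Fin.contractNth 0 (· * ·) q)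
    (h1 : Fin.contractNth (Fin.succ 0) (· * ·) r = Fin.contractNth (Fin.succ 0) (· * ·) q) :
    r = q := by
  have e0 : r 0 = q 0 := by
    rw [← contractNth_succ_zero 0 r, h1, contractNth_succ_zero]
  have e1 : r 1 = q 1 := by
    have := congrFun h0 0
    rw [contractNth_zero_zero, contractNth_zero_zero, e0] at this
    exact mul_left_cancel this
  funext i
  refine Fin.cases e0 (fun i => Fin.cases e1 (fun i => ?_) i) i
  rw [← contractNth_zero_succ r, h0, contractNth_zero_succ]

/-- Compatible rows are the contractions of a row at the first two places. -/
theorem exists_contractNth {B : Type w} [Group B] {n : ℕ} (p q : Fin (n + 1) → B)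
    (h : (Fin.contractNth 0 (· * ·) p : Fin n → B) = Fin.contractNth 0 (· * ·) q) :
    ∃ r : Fin (n + 2) → B, Fin.contractNth 0 (· * ·) r = p ∧
      Fin.contractNth (Fin.succ 0) (· * ·) r = q := by
  -- The witness is forced: the second contraction keeps r₀, so r₀ = q₀; the first starts with r₀r₁
  -- = p₀ and leaves the later entries alone.
  have hr : Fin.contractNth 0 (· * ·)
      (Fin.cons (q 0) (Fin.cons ((q 0)⁻¹ * p 0) (Fin.tail p)) : Fin (n + 2) → B) = p := by
    funext i
    refine Fin.cases ?_ (fun i => ?_) i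
    · rw [contractNth_zero_zero]
      exact mul_inv_cancel_left _ _
    · rw [contractNth_zero_succ]
      rfl
  refine ⟨_, hr, ?_⟩
  cases n with
  | zero =>
    funext i
    obtain rfl : i = 0 := Fin.fin_one_eq_zero i
    rw [contractNth_succ_zero]
    rfl
  | succ n =>
    set r : Fin (n + 3) → B := Fin.cons (q 0) (Fin.cons ((q 0)⁻¹ * p 0) (Fin.tail p))
    -- Contracting twice at the start shows that the second contraction of `r` and `q` agree after
    -- one more contraction; as their first entries also agree, they are equal.
    have h' := contractNth_contractNth 0 0 le_rfl r
    rw [Fin.castSucc_zero, hr, h] at h'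
    have e : Fin.contractNth (Fin.succ 0) (· * ·) r 0 = q 0 := by
      rw [contractNth_succ_zero]; rfl
    funext i
    refine Fin.cases e (fun i => ?_) i
    refine Fin.cases ?_ (fun i => ?_) i
    · have := congrFun h' 0
      rw [contractNth_zero_zero, contractNth_zero_zero, e] at this
      exact mul_left_cancel this
    · rw [← contractNth_zero_succ q, ← h', contractNth_zero_succ]

/-- Successive quotients of the sequence recover the row. Together with `partialProd_injective`,
this lets equations between rows be solved on partial products. -/
theorem exists_partialProd {B : Type w} [Group B] {n : ℕ} (f : Fin (n + 1) → B) (hf : f 0 = 1) :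
    ∃ r : Fin n → B, Fin.partialProd r = f := by
  refine ⟨fun i => (f i.castSucc)⁻¹ * f i.succ, funext fun i => ?_⟩
  induction i using Fin.induction with
  | zero => rw [Fin.partialProd_zero, hf]
  | succ i ih => rw [Fin.partialProd_succ, ih, mul_inv_cancel_left]

theorem partialProd_injective {B : Type w} [Group B] {n : ℕ} {r q : Fin n → B}
    (h : Fin.partialProd r = Fin.partialProd q) : r = q := by
  funext i
  have := congrFun h i.succ
  rw [Fin.partialProd_succ, Fin.partialProd_succ, h] at this
  exact mul_left_cancel this

/-- On partial products, merging with a fixed upper row is left multiplication by known elements, so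
it cancels. -/
theorem mergeRow_right_injective {n : ℕ} {y z : C} (h : z ⟶ y) (r : Fin (n + 1) → A y)
    {p q : Fin n → A z} (e : X.mergeRow h r p = X.mergeRow h r q) : p = q := by
  refine partialProd_injective (funext fun i => ?_)
  have := congrArg (fun f => Fin.partialProd f i) e
  simp only [bd_partialProd_mergeRow] at this
  exact mul_left_cancel this

theorem exists_mergeRow_right {n : ℕ} {y z : C} (h : z ⟶ y) (r : Fin (n + 1) → A y)
    (q : Fin n → A z) : ∃ p : Fin n → A z, X.mergeRow h r p = q := by
  obtain ⟨p, hp⟩ := exists_partialProd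
    (fun i => (X.act h (Fin.partialProd (Fin.tail r) i))⁻¹ * Fin.partialProd q i) (by simp)
  refine ⟨p, partialProd_injective (funext fun i => ?_)⟩
  rw [bd_partialProd_mergeRow, hp, mul_inv_cancel_left]

theorem mergeRow_left_injective {n : ℕ} {y z : C} (h : z ⟶ y) {r q : Fin (n + 1) → A y}
    (p : Fin n → A z) (e : X.mergeRow h r p = X.mergeRow h q p) : Fin.tail r = Fin.tail q := by
  funext i
  have := congrFun e i
  rw [mergeRow, mergeRow] at this
  exact X.act_injective _ (mul_right_cancel this)

/-- The first entry of the upper row does not enter `mergeRow`, hence the arbitrary `a`; it remains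
free to be fixed by another face. -/
theorem exists_mergeRow_left {n : ℕ} {y z : C} (h : z ⟶ y) (p q : Fin n → A z) :
    ∃ r : Fin n → A y, ∀ a : A y, X.mergeRow h (Fin.cons a r) p = q := by
  refine ⟨fun i => X.act (Groupoid.inv (X.bd z (Fin.partialProd p i.castSucc) ≫ h))
    (q i * (p i)⁻¹), fun a => funext fun i => ?_⟩
  rw [mergeRow, Fin.cons_succ, X.act_act_inv, inv_mul_cancel_right]

theorem mergeRow_zero {n : ℕ} {y z : C} (h : z ⟶ y) (r : Fin (n + 2) → A y)
    (p : Fin (n + 1) → A z) : X.mergeRow h r p 0 = X.act h (r 1) * p 0 := by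
  simp [mergeRow]

theorem row_ext {B : Type w} {n : ℕ} {r q : Fin (n + 1) → B} (h0 : r 0 = q 0)
    (h : Fin.tail r = Fin.tail q) : r = q :=
  funext fun i => Fin.cases h0 (fun i => congrFun h i) i

/-- A row is determined by its first entry, the other rows and the face `d₁`. -/
theorem cons_row_ext {n : ℕ} {x y : C} {g : y ⟶ x} {r q : Fin (n + 1) → A y}
    {M : TriMat A (n + 1) y} (h0 : r 0 = q 0)
    (h : X.face 0 (cons g r M) = X.face 0 (cons g q M)) : r = q := by
  obtain _ | ⟨k, p, M⟩ := M
  rw [face_zero_cons, face_zero_cons] at h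
  exact row_ext h0 (X.mergeRow_left_injective _ _ (cons_inj h).2.1)

/-- A matrix is determined by its first row and its face `d₁`. -/
theorem cons_tail_ext {n : ℕ} {x y : C} {g : y ⟶ x} {r : Fin (n + 1) → A y}
    {M N : TriMat A (n + 1) y} (h : X.face 0 (cons g r M) = X.face 0 (cons g r N)) : M = N := by
  obtain _ | ⟨k, p, M⟩ := M
  obtain _ | ⟨k', p', N⟩ := N
  rw [face_zero_cons, face_zero_cons] at h
  cases h' : (cons.inj h).1
  obtain ⟨h1, h2, rfl⟩ := cons_inj h
  obtain rfl : k = k' := by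
    have := (cancel_mono (X.bd y (r 0) ≫ g)).1 h1
    exact this
  rw [X.mergeRow_right_injective _ _ h2]

/-- Only the first row of `M` is unknown: its diagonal entry is obtained by division in the
groupoid, its other entries by `exists_mergeRow_right`. The lower rows are those of `N`. -/
theorem exists_face_zero_cons {n : ℕ} {x y : C} (g : y ⟶ x) (r : Fin (n + 1) → A y)
    (N : TriMat A (n + 1) x) : ∃ M : TriMat A (n + 1) y, X.face 0 (cons g r M) = N := by
  obtain _ | ⟨k, q, N⟩ := N
  obtain ⟨p, hp⟩ := X.exists_mergeRow_right (k ≫ Groupoid.inv (X.bd y (r 0) ≫ g)) r q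
  refine ⟨cons (k ≫ Groupoid.inv (X.bd y (r 0) ≫ g)) p N, ?_⟩
  rw [face_zero_cons, hp, Category.assoc, Groupoid.inv_comp, Category.comp_id]

/-! ### Rigidity: three of the first four faces determine a simplex -/

theorem nerve_d_succ_eq {n : ℕ} {x : C} {j : Fin (n + 1)} {M : TriMat A (n + 1) x}
    {N : TriMat A n x} (h : X.face j M = N) : X.nerve.d j.succ ⟨x, M⟩ = (⟨x, N⟩ : NerveObj A n) :=
  congrArg (Sigma.mk x) h

theorem face_eq_of_nerve_d_eq {n : ℕ} {x : C} {i j : Fin (n + 1)} {M N : TriMat A (n + 1) x}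
    (h : X.nerve.d i.succ ⟨x, M⟩ = X.nerve.d j.succ ⟨x, N⟩) : X.face i M = X.face j N :=
  eq_of_heq (Sigma.mk.inj h).2

/-- Since d₀ changes x₀, the conclusion stays in the sigma type; eliminating it identifies the
objects along with the matrices. -/
theorem eq_face_of_nerve_d_zero_eq {n : ℕ} {x y z : C} {j : Fin (n + 1)} {g : y ⟶ x}
    {r : Fin n → A y} {M : TriMat A n y} {N : TriMat A (n + 1) z}
    (h : X.nerve.d 0 ⟨x, cons g r M⟩ = X.nerve.d j.succ ⟨z, N⟩) :
    (⟨y, M⟩ : NerveObj A n) = ⟨z, X.face j N⟩ := h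

theorem nerve_ext_zero {n : ℕ} {y z : X.nerve.obj (n + 3)}
    (h1 : X.nerve.d (Fin.succ 0) y = X.nerve.d (Fin.succ 0) z)
    (h2 : X.nerve.d (Fin.succ (Fin.succ 0)) y = X.nerve.d (Fin.succ (Fin.succ 0)) z)
    (h3 : X.nerve.d (Fin.succ (Fin.succ (Fin.succ 0))) y =
      X.nerve.d (Fin.succ (Fin.succ (Fin.succ 0))) z) : y = z := by
  obtain ⟨x, _ | ⟨g, r, M⟩⟩ := y
  obtain ⟨x', _ | ⟨g', r', M'⟩⟩ := z
  obtain rfl : x = x' := congrArg Sigma.fst h1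
  have h1 := X.face_eq_of_nerve_d_eq h1
  have h2 := X.face_eq_of_nerve_d_eq h2
  have h3 := X.face_eq_of_nerve_d_eq h3
  rw [face_succ_cons, face_succ_cons] at h2 h3
  -- The objects x₁ must be identified before the rows can be compared by honest equalities.
  cases (TriMat.cons.inj h2).1
  obtain ⟨rfl, h2, -⟩ := TriMat.cons_inj h2
  obtain rfl := contractNth_injective h2 (TriMat.cons_inj h3).2.1
  rw [X.cons_tail_ext h1]

theorem nerve_ext_one {n : ℕ} {y z : X.nerve.obj (n + 3)}
    (h0 : X.nerve.d 0 y = X.nerve.d 0 z)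
    (h2 : X.nerve.d (Fin.succ (Fin.succ 0)) y = X.nerve.d (Fin.succ (Fin.succ 0)) z)
    (h3 : X.nerve.d (Fin.succ (Fin.succ (Fin.succ 0))) y =
      X.nerve.d (Fin.succ (Fin.succ (Fin.succ 0))) z) : y = z := by
  obtain ⟨x, _ | ⟨g, r, M⟩⟩ := y
  obtain ⟨x', _ | ⟨g', r', M'⟩⟩ := z
  cases h0
  obtain rfl : x = x' := congrArg Sigma.fst h2
  have h2 := X.face_eq_of_nerve_d_eq h2
  have h3 := X.face_eq_of_nerve_d_eq h3
  rw [face_succ_cons, face_succ_cons] at h2 h3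
  obtain ⟨rfl, h2, -⟩ := TriMat.cons_inj h2
  obtain rfl := contractNth_injective h2 (TriMat.cons_inj h3).2.1
  rfl

theorem nerve_ext_two {n : ℕ} {y z : X.nerve.obj (n + 3)}
    (h0 : X.nerve.d 0 y = X.nerve.d 0 z)
    (h1 : X.nerve.d (Fin.succ 0) y = X.nerve.d (Fin.succ 0) z)
    (h3 : X.nerve.d (Fin.succ (Fin.succ (Fin.succ 0))) y =
      X.nerve.d (Fin.succ (Fin.succ (Fin.succ 0))) z) : y = z := by
  obtain ⟨x, _ | ⟨g, r, M⟩⟩ := y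
  obtain ⟨x', _ | ⟨g', r', M'⟩⟩ := z
  cases h0
  obtain rfl : x = x' := congrArg Sigma.fst h1
  have h1 := X.face_eq_of_nerve_d_eq h1
  have h3 := X.face_eq_of_nerve_d_eq h3
  rw [face_succ_cons, face_succ_cons] at h3
  obtain ⟨rfl, h3, -⟩ := TriMat.cons_inj h3
  have e := congrFun h3 0
  rw [contractNth_succ_zero, contractNth_succ_zero] at e
  rw [X.cons_row_ext e h1]

theorem nerve_ext_three {n : ℕ} {y z : X.nerve.obj (n + 3)}
    (h0 : X.nerve.d 0 y = X.nerve.d 0 z)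
    (h1 : X.nerve.d (Fin.succ 0) y = X.nerve.d (Fin.succ 0) z)
    (h2 : X.nerve.d (Fin.succ (Fin.succ 0)) y = X.nerve.d (Fin.succ (Fin.succ 0)) z) :
    y = z := by
  obtain ⟨x, _ | ⟨g, r, _ | ⟨h, p, M⟩⟩⟩ := y
  obtain ⟨x', _ | ⟨g', q, M'⟩⟩ := z
  cases h0
  obtain rfl : x = x' := congrArg Sigma.fst h1
  have h1 := X.face_eq_of_nerve_d_eq h1
  have h2 := X.face_eq_of_nerve_d_eq h2
  rw [face_succ_cons, face_succ_cons] at h2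
  obtain ⟨rfl, h2, -⟩ := TriMat.cons_inj h2
  -- d₁ determines r₁ and d₂ determines the product r₀r₁.
  have e : r 0 = q 0 := by
    have e := congrFun h2 0
    have e1 : r 1 = q 1 := congrFun
      (X.mergeRow_left_injective _ _ (TriMat.cons_inj h1).2.1) 0
    rw [contractNth_zero_zero, contractNth_zero_zero, e1] at e
    exact mul_right_cancel e
  rw [X.cons_row_ext e h1]

/-! ### Filling three compatible faces among the first four -/

theorem exists_nerve_zero {n : ℕ} {x1 x2 x3 : X.nerve.obj (n + 2)}
    (h12 : X.nerve.d (Fin.succ 0) x2 = X.nerve.d (Fin.succ 0) x1)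
    (h13 : X.nerve.d (Fin.succ 0) x3 = X.nerve.d (Fin.succ (Fin.succ 0)) x1)
    (h23 : X.nerve.d (Fin.succ (Fin.succ 0)) x3 = X.nerve.d (Fin.succ (Fin.succ 0)) x2) :
    ∃ w : X.nerve.obj (n + 3), X.nerve.d (Fin.succ 0) w = x1 ∧
      X.nerve.d (Fin.succ (Fin.succ 0)) w = x2 ∧
      X.nerve.d (Fin.succ (Fin.succ (Fin.succ 0))) w = x3 := by
  obtain ⟨x, _ | ⟨g, p, M⟩⟩ := x2
  obtain ⟨x', _ | ⟨g', q, M'⟩⟩ := x3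
  obtain ⟨x'', N⟩ := x1
  obtain rfl : x = x'' := congrArg Sigma.fst h12
  obtain rfl : x' = x := congrArg Sigma.fst h13
  have h12 := X.face_eq_of_nerve_d_eq h12
  have h13 := X.face_eq_of_nerve_d_eq h13
  have h23 := X.face_eq_of_nerve_d_eq h23
  rw [face_succ_cons, face_succ_cons] at h23
  cases (TriMat.cons.inj h23).1
  obtain ⟨rfl, h23, -⟩ := TriMat.cons_inj h23
  obtain ⟨r, hr, hr'⟩ := exists_contractNth p q h23.symm
  obtain ⟨L, rfl⟩ := X.exists_face_zero_cons g' r N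
  refine ⟨⟨x', cons g' r L⟩, rfl, X.nerve_d_succ_eq ?_, X.nerve_d_succ_eq ?_⟩
  -- The first row of d₂ is right by construction. Its d₁ is right by the simplicial identity and
  -- `h12`, which determines the other rows.
  · have e := X.face_face 0 0 le_rfl (cons g' r L)
    rw [face_succ_cons, hr, Fin.castSucc_zero, ← h12] at e
    rw [face_succ_cons, hr, X.cons_tail_ext e]
  · have e := X.face_face 0 (Fin.succ 0) (Fin.zero_le _) (cons g' r L)
    rw [face_succ_cons, hr', Fin.castSucc_zero, ← h13] at e
    rw [face_succ_cons, hr', X.cons_tail_ext e]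

theorem exists_nerve_one {n : ℕ} {x0 x2 x3 : X.nerve.obj (n + 2)}
    (h02 : X.nerve.d 0 x2 = X.nerve.d (Fin.succ 0) x0)
    (h03 : X.nerve.d 0 x3 = X.nerve.d (Fin.succ (Fin.succ 0)) x0)
    (h23 : X.nerve.d (Fin.succ (Fin.succ 0)) x3 = X.nerve.d (Fin.succ (Fin.succ 0)) x2) :
    ∃ w : X.nerve.obj (n + 3), X.nerve.d 0 w = x0 ∧
      X.nerve.d (Fin.succ (Fin.succ 0)) w = x2 ∧
      X.nerve.d (Fin.succ (Fin.succ (Fin.succ 0))) w = x3 := by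
  obtain ⟨x, _ | ⟨g, p, M⟩⟩ := x2
  obtain ⟨x', _ | ⟨g', q, M'⟩⟩ := x3
  obtain ⟨y, N⟩ := x0
  cases X.eq_face_of_nerve_d_zero_eq h02
  cases X.eq_face_of_nerve_d_zero_eq h03
  obtain rfl : x' = x := congrArg Sigma.fst h23
  have h23 := X.face_eq_of_nerve_d_eq h23
  rw [face_succ_cons, face_succ_cons] at h23
  obtain ⟨rfl, h23, -⟩ := TriMat.cons_inj h23
  obtain ⟨r, rfl, rfl⟩ := exists_contractNth p q h23.symm
  exact ⟨⟨x', cons g' r N⟩, rfl, X.nerve_d_succ_eq (X.face_succ_cons _ _ _ _),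
    X.nerve_d_succ_eq (X.face_succ_cons _ _ _ _)⟩

theorem exists_nerve_two {n : ℕ} {x0 x1 x3 : X.nerve.obj (n + 2)}
    (h01 : X.nerve.d 0 x1 = X.nerve.d 0 x0)
    (h03 : X.nerve.d 0 x3 = X.nerve.d (Fin.succ (Fin.succ 0)) x0)
    (h13 : X.nerve.d (Fin.succ 0) x3 = X.nerve.d (Fin.succ (Fin.succ 0)) x1) :
    ∃ w : X.nerve.obj (n + 3), X.nerve.d 0 w = x0 ∧
      X.nerve.d (Fin.succ 0) w = x1 ∧
      X.nerve.d (Fin.succ (Fin.succ (Fin.succ 0))) w = x3 := by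
  obtain ⟨y, _ | ⟨h, p, M⟩⟩ := x0
  obtain ⟨x, _ | ⟨k, q, M'⟩⟩ := x1
  obtain ⟨x', _ | ⟨g, s, N⟩⟩ := x3
  cases h01
  cases X.eq_face_of_nerve_d_zero_eq h03
  obtain rfl : x' = x := congrArg Sigma.fst h13
  have h13 := X.face_eq_of_nerve_d_eq h13
  obtain ⟨t, ht⟩ := X.exists_mergeRow_left h p q
  -- Compatibility of d₁x₃ with d₂x₁, read at the top diagonal entry.
  have hk : h ≫ X.bd y (s 0) ≫ g = k := by
    rw [face_succ_cons, face_succ_cons, face_zero_cons] at h13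
    exact (TriMat.cons_inj h13).1
  refine ⟨⟨x', cons g (Fin.cons (s 0) t) (cons h p M)⟩, rfl, X.nerve_d_succ_eq ?_,
    X.nerve_d_succ_eq ?_⟩
  · rw [face_zero_cons, ht, Fin.cons_zero, hk]
  · have e := X.face_face 0 (Fin.succ 0) (Fin.zero_le _) (cons g (Fin.cons (s 0) t) (cons h p M))
    rw [face_succ_cons, Fin.castSucc_zero, face_zero_cons, ht, Fin.cons_zero, hk, ← h13] at e
    rw [face_succ_cons]
    congr 1
    refine X.cons_row_ext ?_ e
    rw [contractNth_succ_zero, Fin.cons_zero]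

theorem exists_nerve_three {n : ℕ} {x0 x1 x2 : X.nerve.obj (n + 2)}
    (h01 : X.nerve.d 0 x1 = X.nerve.d 0 x0)
    (h02 : X.nerve.d 0 x2 = X.nerve.d (Fin.succ 0) x0)
    (h12 : X.nerve.d (Fin.succ 0) x2 = X.nerve.d (Fin.succ 0) x1) :
    ∃ w : X.nerve.obj (n + 3), X.nerve.d 0 w = x0 ∧
      X.nerve.d (Fin.succ 0) w = x1 ∧
      X.nerve.d (Fin.succ (Fin.succ 0)) w = x2 := by
  obtain ⟨y, _ | ⟨h, p, _ | ⟨l, m, M⟩⟩⟩ := x0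
  obtain ⟨x, _ | ⟨k, q, M'⟩⟩ := x1
  obtain ⟨x', _ | ⟨g, s, N⟩⟩ := x2
  cases h01
  cases X.eq_face_of_nerve_d_zero_eq h02
  obtain rfl : x' = x := congrArg Sigma.fst h12
  have h12 := X.face_eq_of_nerve_d_eq h12
  obtain ⟨t, ht⟩ := X.exists_mergeRow_left h p q
  -- The face d₁ prescribes the tail `t` and d₂ prescribes r₀t₀ = s₀, so r₀ = s₀t₀⁻¹. That the
  -- diagonal entry of d₁ is then `k` follows from `h12` by cancelling `l` and `∂(p 0)` and moving
  -- `∂(t 0)` across `h`.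
  have hk : h ≫ X.bd y (s 0 * (t 0)⁻¹) ≫ g = k := by
    rw [face_zero_cons, face_zero_cons, face_zero_cons] at h12
    have e := (TriMat.cons_inj h12).1
    -- The argument `1` is an arbitrary first entry.
    rw [← ht 1, mergeRow_zero, map_mul, End.mul_def] at e
    simp only [Category.assoc, cancel_epi] at e
    have e1 : X.bd y (s 0) = X.bd y (t 0) ≫ X.bd y (s 0 * (t 0)⁻¹) := by
      rw [← End.mul_def, ← map_mul, inv_mul_cancel_right]
    rw [← cancel_epi (X.bd _ (X.act h (t 0)))]
    refine Eq.trans ?_ e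
    rw [← Category.assoc, X.bd_act, e1, Category.assoc, Category.assoc]
  refine ⟨⟨x', cons g (Fin.cons (s 0 * (t 0)⁻¹) t) (cons h p (cons l m M))⟩, rfl,
    X.nerve_d_succ_eq ?_, X.nerve_d_succ_eq ?_⟩
  · rw [face_zero_cons, ht, Fin.cons_zero, hk]
  · have e := X.face_face 0 0 le_rfl
      (cons g (Fin.cons (s 0 * (t 0)⁻¹) t) (cons h p (cons l m M)))
    rw [face_succ_cons, Fin.castSucc_zero, face_zero_cons _ _ _ h, ht, Fin.cons_zero, hk,
      ← h12] at e
    rw [face_succ_cons]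
    congr 1
    refine X.cons_row_ext ?_ e
    rw [contractNth_zero_zero]
    exact inv_mul_cancel_right _ _

end CrossedMonoid

/-! ### Generalities on horns and homotopy classes -/

namespace SimpSet

variable {X : SimpSet.{u}}

/-- If the `i`-th face of `w` is the one prescribed by a horn, then every later face of `w` has the
same `i`-th face as the prescribed one. -/
theorem d_eq_of_horn {n : ℕ} {l : Fin (n + 3)} {x : Fin (n + 3) → X.obj (n + 1)}
    (hx : ∀ i j : Fin (n + 2), i ≤ j → i.castSucc ≠ l → j.succ ≠ l →
      X.d i (x j.succ) = X.d j (x i.castSucc)) {w : X.obj (n + 2)} {i j : Fin (n + 2)}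
    (hij : i ≤ j) (hi : i.castSucc ≠ l) (hj : j.succ ≠ l) (hw : X.d i.castSucc w = x i.castSucc) :
    X.d i (X.d j.succ w) = X.d i (x j.succ) := by
  rw [X.d_d i j hij, hw, hx i j hij hi hj]

theorem HomotopyGroup.mk_eq_mk_iff [X.IsKan] {n : ℕ} {x : X.obj 0} {y z : Sphere n x} :
    HomotopyGroup.mk y = HomotopyGroup.mk z ↔ y.Rel z :=
  ⟨fun h => rel_equivalence.eqvGen_iff.1 (Quot.eqvGen_exact h), fun h => Quot.sound h⟩

end SimpSet

/-! ### The Kan condition for the nerve -/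

namespace CrossedMonoid

open TriMat

variable {C : Type u} [Groupoid.{v} C] {A : C → Type w} [∀ t, Group (A t)]
  (X : CrossedMonoid C A)

/-- Such a horn prescribes one vertex, at the only index `Fin.rev l` other than `l`; the degenerate
edge on it is a filler. -/
theorem nerve_horn_one (l : Fin 2) (x : Fin 2 → X.nerve.obj 0) :
    ∃ w : X.nerve.obj 1, ∀ j, j ≠ l → X.nerve.d j w = x j := by
  refine ⟨X.nerve.s 0 (x (Fin.rev l)), fun j hj => ?_⟩
  obtain rfl : j = Fin.rev l := by
    revert hj
    fin_cases l <;> fin_cases j <;> simp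
  generalize Fin.rev l = j
  refine Fin.cases ?_ (fun j => ?_) j
  · exact X.nerve.d_s_self 0 _
  · obtain rfl : j = 0 := Fin.fin_one_eq_zero j
    exact X.nerve.d_s_succ 0 _

/-- A `1`-simplex given by a morphism. -/
def edge {x y : C} (g : y ⟶ x) : X.nerve.obj 1 := ⟨x, cons g (fun _ => 1) (nil y)⟩

/-- A `2`-simplex given by its entries. -/
def triangle {x y z : C} (g : y ⟶ x) (a : A y) (h : z ⟶ y) : X.nerve.obj 2 :=
  ⟨x, cons g (fun _ => a) (cons h (fun _ => 1) (nil z))⟩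

theorem exists_eq_edge (w : X.nerve.obj 1) : ∃ (x y : C) (g : y ⟶ x), w = X.edge g := by
  obtain ⟨x, _ | ⟨g, r, _ | _⟩⟩ := w
  obtain rfl : r = fun _ => 1 := funext fun i => i.elim0
  exact ⟨_, _, g, rfl⟩

theorem exists_eq_triangle (w : X.nerve.obj 2) :
    ∃ (x y z : C) (g : y ⟶ x) (a : A y) (h : z ⟶ y), w = X.triangle g a h := by
  obtain ⟨x, _ | ⟨g, r, _ | ⟨h, r', _ | _⟩⟩⟩ := w
  obtain rfl : r' = fun _ => 1 := funext fun i => i.elim0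
  obtain ⟨a, rfl⟩ : ∃ a, r = fun _ => a := ⟨r 0, funext fun i => by rw [Fin.fin_one_eq_zero i]⟩
  exact ⟨_, _, _, g, a, h, rfl⟩

theorem d_zero_triangle {x y z : C} (g : y ⟶ x) (a : A y) (h : z ⟶ y) :
    X.nerve.d 0 (X.triangle g a h) = X.edge h := rfl

theorem d_one_triangle {x y z : C} (g : y ⟶ x) (a : A y) (h : z ⟶ y) :
    X.nerve.d (Fin.succ 0) (X.triangle g a h) = X.edge (h ≫ X.bd y a ≫ g) := by
  refine X.nerve_d_succ_eq ?_
  rw [face_zero_cons]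
  congr 1
  exact funext fun i => i.elim0

theorem d_two_triangle {x y z : C} (g : y ⟶ x) (a : A y) (h : z ⟶ y) :
    X.nerve.d (Fin.succ (Fin.succ 0)) (X.triangle g a h) = X.edge g := by
  refine X.nerve_d_succ_eq ?_
  rw [face_succ_cons]
  congr 1
  exact funext fun i => i.elim0

theorem d_zero_edge {x y : C} (g : y ⟶ x) : X.nerve.d 0 (X.edge g) = X.vertex y := rfl

theorem d_one_edge {x y : C} (g : y ⟶ x) : X.nerve.d (Fin.succ 0) (X.edge g) = X.vertex x := rfl

theorem vertex_injective : Function.Injective X.vertex := fun _ _ h => congrArg Sigma.fst h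

theorem edge_injective {x y : C} {g g' : y ⟶ x} (h : X.edge g = X.edge g') : g = g' :=
  (TriMat.cons_inj (eq_of_heq (Sigma.mk.inj h).2)).1

/-- Indices are kept as successors, the form in which the face formulas apply. -/
theorem forall_fin_three {P : Fin 3 → Prop} :
    (∀ j, P j) ↔ P 0 ∧ P (Fin.succ 0) ∧ P (Fin.succ (Fin.succ 0)) := by
  rw [Fin.forall_fin_succ, Fin.forall_fin_succ, Fin.forall_fin_one]

/-- The entry in `A` can be taken to be 1; the missing edge is then a composite or a quotient in the
groupoid. -/
theorem nerve_horn_two (l : Fin 3) (x : Fin 3 → X.nerve.obj 1)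
    (hx : ∀ i j : Fin 2, i ≤ j → i.castSucc ≠ l → j.succ ≠ l →
      X.nerve.d i (x j.succ) = X.nerve.d j (x i.castSucc)) :
    ∃ w : X.nerve.obj 2, ∀ j, j ≠ l → X.nerve.d j w = x j := by
  simp only [forall_fin_three]
  obtain ⟨_, _, g0, e0⟩ := X.exists_eq_edge (x 0)
  obtain ⟨_, _, g1, e1⟩ := X.exists_eq_edge (x (Fin.succ 0))
  obtain ⟨_, _, g2, e2⟩ := X.exists_eq_edge (x (Fin.succ (Fin.succ 0)))
  have h01 := hx 0 0 le_rfl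
  have h02 := hx 0 (Fin.succ 0) (Fin.zero_le _)
  have h12 := hx (Fin.succ 0) (Fin.succ 0) le_rfl
  change _ → _ → X.nerve.d 0 (x (Fin.succ 0)) = X.nerve.d 0 (x 0) at h01
  change _ → _ → X.nerve.d 0 (x (Fin.succ (Fin.succ 0))) = X.nerve.d (Fin.succ 0) (x 0) at h02
  change _ → _ → X.nerve.d (Fin.succ 0) (x (Fin.succ (Fin.succ 0))) =
    X.nerve.d (Fin.succ 0) (x (Fin.succ 0)) at h12
  rw [e0, e1, d_zero_edge, d_zero_edge] at h01
  rw [e0, e2, d_zero_edge, d_one_edge] at h02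
  rw [e1, e2, d_one_edge, d_one_edge] at h12
  rw [e0, e1, e2]
  fin_cases l
  · obtain rfl := X.vertex_injective (h12 (by decide) (by decide))
    refine ⟨X.triangle g2 1 (g1 ≫ Groupoid.inv g2), fun h => (h rfl).elim, fun _ => ?_,
      fun _ => X.d_two_triangle _ _ _⟩
    rw [d_one_triangle, map_one, End.one_def, Category.id_comp, Category.assoc,
      Groupoid.inv_comp, Category.comp_id]
  · obtain rfl := X.vertex_injective (h02 (by decide) (by decide))
    exact ⟨X.triangle g2 1 g0, fun _ => X.d_zero_triangle _ _ _, fun h => (h rfl).elim,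
      fun _ => X.d_two_triangle _ _ _⟩
  · obtain rfl := X.vertex_injective (h01 (by decide) (by decide))
    refine ⟨X.triangle (Groupoid.inv g0 ≫ g1) 1 g0, fun _ => X.d_zero_triangle _ _ _,
      fun _ => ?_, fun h => (h rfl).elim⟩
    rw [d_one_triangle, map_one, End.one_def, Category.id_comp, ← Category.assoc,
      Groupoid.comp_inv, Category.id_comp]

/-- The filler comes from three prescribed faces among d₀, …, d₃: those other than the `l`-th, or
d₀, d₁, d₂ if `l` is at least 3. Any further prescribed face is correct by rigidity. -/
theorem nerve_horn_succ {n : ℕ} (l : Fin (n + 4)) (x : Fin (n + 4) → X.nerve.obj (n + 2))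
    (hx : ∀ i j : Fin (n + 3), i ≤ j → i.castSucc ≠ l → j.succ ≠ l →
      X.nerve.d i (x j.succ) = X.nerve.d j (x i.castSucc)) :
    ∃ w : X.nerve.obj (n + 3), ∀ j, j ≠ l → X.nerve.d j w = x j := by
  have h01 : (0 : Fin (n + 4)) ≠ l → Fin.succ 0 ≠ l →
    X.nerve.d 0 (x (Fin.succ 0)) = X.nerve.d 0 (x 0) := hx 0 0 le_rfl
  have h02 : (0 : Fin (n + 4)) ≠ l → Fin.succ (Fin.succ 0) ≠ l →
    X.nerve.d 0 (x (Fin.succ (Fin.succ 0))) = X.nerve.d (Fin.succ 0) (x 0) :=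
    hx 0 (Fin.succ 0) (Fin.zero_le _)
  have h12 : Fin.succ 0 ≠ l → Fin.succ (Fin.succ 0) ≠ l →
    X.nerve.d (Fin.succ 0) (x (Fin.succ (Fin.succ 0))) =
      X.nerve.d (Fin.succ 0) (x (Fin.succ 0)) := hx (Fin.succ 0) (Fin.succ 0) le_rfl
  have h03 : (0 : Fin (n + 4)) ≠ l → Fin.succ (Fin.succ (Fin.succ 0)) ≠ l →
    X.nerve.d 0 (x (Fin.succ (Fin.succ (Fin.succ 0)))) =
      X.nerve.d (Fin.succ (Fin.succ 0)) (x 0) := hx 0 (Fin.succ (Fin.succ 0)) (Fin.zero_le _)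
  have h13 : Fin.succ 0 ≠ l → Fin.succ (Fin.succ (Fin.succ 0)) ≠ l →
    X.nerve.d (Fin.succ 0) (x (Fin.succ (Fin.succ (Fin.succ 0)))) =
      X.nerve.d (Fin.succ (Fin.succ 0)) (x (Fin.succ 0)) :=
    hx (Fin.succ 0) (Fin.succ (Fin.succ 0)) (Fin.succ_le_succ_iff.2 (Fin.zero_le _))
  have h23 : Fin.succ (Fin.succ 0) ≠ l → Fin.succ (Fin.succ (Fin.succ 0)) ≠ l →
    X.nerve.d (Fin.succ (Fin.succ 0)) (x (Fin.succ (Fin.succ (Fin.succ 0)))) =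
      X.nerve.d (Fin.succ (Fin.succ 0)) (x (Fin.succ (Fin.succ 0))) :=
    hx (Fin.succ (Fin.succ 0)) (Fin.succ (Fin.succ 0)) le_rfl
  have k0 : ∀ (w : X.nerve.obj (n + 3)) (j : Fin (n + 3)), 0 ≠ l → j.succ ≠ l →
    X.nerve.d 0 w = x 0 → X.nerve.d 0 (X.nerve.d j.succ w) = X.nerve.d 0 (x j.succ) :=
    fun w j h => SimpSet.d_eq_of_horn hx (i := 0) (Fin.zero_le j) h
  have k1 : ∀ (w : X.nerve.obj (n + 3)) (j : Fin (n + 2)), Fin.succ 0 ≠ l → j.succ.succ ≠ l →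
    X.nerve.d (Fin.succ 0) w = x (Fin.succ 0) →
    X.nerve.d (Fin.succ 0) (X.nerve.d j.succ.succ w) =
      X.nerve.d (Fin.succ 0) (x j.succ.succ) :=
    fun w j h => SimpSet.d_eq_of_horn hx (i := Fin.succ 0)
      (Fin.succ_le_succ_iff.2 (Fin.zero_le j)) h
  have k2 : ∀ (w : X.nerve.obj (n + 3)) (j : Fin (n + 1)), Fin.succ (Fin.succ 0) ≠ l →
    j.succ.succ.succ ≠ l →
    X.nerve.d (Fin.succ (Fin.succ 0)) w = x (Fin.succ (Fin.succ 0)) →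
    X.nerve.d (Fin.succ (Fin.succ 0)) (X.nerve.d j.succ.succ.succ w) =
      X.nerve.d (Fin.succ (Fin.succ 0)) (x j.succ.succ.succ) :=
    fun w j h => SimpSet.d_eq_of_horn hx (i := Fin.succ (Fin.succ 0))
      (Fin.succ_le_succ_iff.2 (Fin.succ_le_succ_iff.2 (Fin.zero_le j))) h
  -- The index 3 exists in `Fin (n + 3)` only for positive `n`, so the statement is made for a
  -- general index.
  have k3 : ∀ (w : X.nerve.obj (n + 3)) (j i' : Fin (n + 3)) (i : Fin (n + 4)), i' ≤ j →
    i'.castSucc = i → i ≠ l → j.succ ≠ l → X.nerve.d i w = x i →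
    X.nerve.d i' (X.nerve.d j.succ w) = X.nerve.d i' (x j.succ) := by
    rintro w j i' _ hij rfl hi hj hw
    exact SimpSet.d_eq_of_horn hx hij hi hj hw
  have n0 : ∀ l : Fin (n + 3), (0 : Fin (n + 4)) ≠ l.succ := fun l => (Fin.succ_ne_zero l).symm
  have n1 : ∀ l : Fin (n + 2), Fin.succ 0 ≠ l.succ.succ := fun l =>
    (Fin.succ_injective _).ne (Fin.succ_ne_zero l).symm
  have n2 : ∀ l : Fin (n + 1), Fin.succ (Fin.succ 0) ≠ l.succ.succ.succ :=
    fun l => (Fin.succ_injective _).ne ((Fin.succ_injective _).ne (Fin.succ_ne_zero l).symm)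
  clear hx
  induction l using Fin.cases with
  | zero =>
    obtain ⟨w, h1, h2, h3⟩ := X.exists_nerve_zero (h12 (n0 _).symm (n0 _).symm)
      (h13 (n0 _).symm (n0 _).symm) (h23 (n0 _).symm (n0 _).symm)
    refine ⟨w, fun j => Fin.cases (fun h => (h rfl).elim) (fun j => Fin.cases (fun _ => h1)
      (fun j => Fin.cases (fun _ => h2) (fun j => Fin.cases (fun _ => h3) (fun j hj => ?_) j)
      j) j) j⟩
    cases n with
    | zero => exact j.elim0
    | succ n =>
      exact X.nerve_ext_zero (k1 w _ (n0 _).symm hj h1) (k2 w _ (n0 _).symm hj h2)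
        (k3 w _ _ (Fin.succ (Fin.succ (Fin.succ 0)))
          (Fin.succ_le_succ_iff.2 (Fin.succ_le_succ_iff.2
            (Fin.succ_le_succ_iff.2 (Fin.zero_le j)))) rfl (n0 _).symm hj h3)
  | succ l =>
  induction l using Fin.cases with
  | zero =>
    obtain ⟨w, h0, h2, h3⟩ := X.exists_nerve_one (h02 (n0 _) (n1 _).symm)
      (h03 (n0 _) (n1 _).symm) (h23 (n1 _).symm (n1 _).symm)
    refine ⟨w, fun j => Fin.cases (fun _ => h0) (fun j => Fin.cases (fun h => (h rfl).elim)
      (fun j => Fin.cases (fun _ => h2) (fun j => Fin.cases (fun _ => h3) (fun j hj => ?_) j)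
      j) j) j⟩
    cases n with
    | zero => exact j.elim0
    | succ n =>
      exact X.nerve_ext_one (k0 w _ (n0 _) hj h0) (k2 w _ (n1 _).symm hj h2)
        (k3 w _ _ (Fin.succ (Fin.succ (Fin.succ 0)))
          (Fin.succ_le_succ_iff.2 (Fin.succ_le_succ_iff.2
            (Fin.succ_le_succ_iff.2 (Fin.zero_le j)))) rfl (n1 _).symm hj h3)
  | succ l =>
  induction l using Fin.cases with
  | zero =>
    obtain ⟨w, h0, h1, h3⟩ := X.exists_nerve_two (h01 (n0 _) (n1 _))
      (h03 (n0 _) (n2 _).symm) (h13 (n1 _) (n2 _).symm)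
    refine ⟨w, fun j => Fin.cases (fun _ => h0) (fun j => Fin.cases (fun _ => h1)
      (fun j => Fin.cases (fun h => (h rfl).elim)
      (fun j => Fin.cases (fun _ => h3) (fun j hj => ?_) j) j) j) j⟩
    cases n with
    | zero => exact j.elim0
    | succ n =>
      exact X.nerve_ext_two (k0 w _ (n0 _) hj h0) (k1 w _ (n1 _) hj h1)
        (k3 w _ _ (Fin.succ (Fin.succ (Fin.succ 0)))
          (Fin.succ_le_succ_iff.2 (Fin.succ_le_succ_iff.2
            (Fin.succ_le_succ_iff.2 (Fin.zero_le j)))) rfl (n2 _).symm hj h3)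
  | succ l =>
    obtain ⟨w, h0, h1, h2⟩ := X.exists_nerve_three (h01 (n0 _) (n1 _))
      (h02 (n0 _) (n2 _)) (h12 (n1 _) (n2 _))
    refine ⟨w, fun j => Fin.cases (fun _ => h0) (fun j => Fin.cases (fun _ => h1)
      (fun j => Fin.cases (fun _ => h2) (fun j hj => ?_) j) j) j⟩
    cases n with
    -- In dimension 3 the only face beyond d₀, d₁, d₂ is the missing one.
    | zero => exact (hj (by rw [Fin.fin_one_eq_zero j, Fin.fin_one_eq_zero l])).elim
    | succ n =>
      exact X.nerve_ext_three (k0 w _ (n0 _) hj h0) (k1 w _ (n1 _) hj h1) (k2 w _ (n2 _) hj h2)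

theorem nerve_isKan : X.nerve.IsKan where
  horn_one := X.nerve_horn_one
  horn {n} := by
    cases n with
    | zero => exact X.nerve_horn_two
    | succ n => exact X.nerve_horn_succ

/-! ### Rigidity of spheres -/

/-- This concerns π_{n+3}: two spheres of dimension n + 3 have the same faces, hence coincide even
before passing to classes. -/
theorem subsingleton_homotopyGroup (n : ℕ) (x : X.nerve.obj 0) :
    Subsingleton (X.nerve.HomotopyGroup (n + 2) x) := by
  refine ⟨?_⟩
  rintro ⟨y⟩ ⟨z⟩
  refine congrArg _ (Subtype.ext (X.nerve_ext_three ?_ ?_ ?_)) <;> rw [y.2, z.2]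

/-- A simplex witnessing `y ∼ z` and the degenerate one witnessing `y ∼ y` agree on all faces but
the last. They have dimension at least 3, so they coincide, and so do their last faces. -/
theorem eq_of_sphere_rel {n : ℕ} {x : X.nerve.obj 0} {y z : SimpSet.Sphere (n + 1) x}
    (h : y.Rel z) : y = z := by
  obtain ⟨w, hw⟩ := h
  obtain ⟨w', hw'⟩ := SimpSet.tri_one_self y
  have e : ∀ j : Fin (n + 3), X.nerve.d j.castSucc w = X.nerve.d j.castSucc w' := fun j => by
    rw [hw, hw']
    simp only [SimpSet.tuple, Fin.val_castSucc]
    split_ifs <;> first | rfl | omega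
  obtain rfl : w = w' := X.nerve_ext_three (e 0) (e (Fin.succ 0)) (e (Fin.succ (Fin.succ 0)))
  have h' := (hw' (Fin.last _)).symm.trans (hw (Fin.last _))
  simp only [SimpSet.tuple, Fin.val_last] at h'
  refine Subtype.ext ?_
  simpa using h'

/-! ### Spheres of dimension one and two -/

theorem pt_one (t : C) : SimpSet.pt (X := X.nerve) (X.vertex t) 1 = X.edge (𝟙 t) := rfl

/-- The `1`-sphere given by an automorphism. -/
def edgeSphere {t : C} (g : End t) : SimpSet.Sphere (X := X.nerve) 0 (X.vertex t) :=
  ⟨X.edge g, Fin.forall_fin_two.2 ⟨X.d_zero_edge g, X.d_one_edge g⟩⟩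

theorem edgeSphere_one (t : C) : X.edgeSphere (1 : End t) = SimpSet.Sphere.one 0 (X.vertex t) :=
  rfl

theorem exists_eq_edgeSphere {t : C} (y : SimpSet.Sphere (X := X.nerve) 0 (X.vertex t)) :
    ∃ g : End t, y = X.edgeSphere g := by
  obtain ⟨w, hw⟩ := y
  obtain ⟨x, y, g, rfl⟩ := X.exists_eq_edge w
  obtain rfl : y = t := X.vertex_injective (hw 0)
  obtain rfl : x = y := X.vertex_injective (hw (Fin.succ 0))
  exact ⟨g, rfl⟩

/-- The formula is d₁ of a triangle with entry `a`. With `a = 1` it shows that the class of `f`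
times that of `h` is the class of `h * f`: the product on π₁ is opposite to composition. -/
theorem tri_edgeSphere_iff {t : C} (f g h : End t) :
    SimpSet.Tri (X.edgeSphere f) (X.edgeSphere g) (X.edgeSphere h) ↔
      ∃ a : A t, h * X.bd t a * f = g := by
  constructor
  · rintro ⟨w, hw⟩
    obtain ⟨x, y, z, k, a, l, rfl⟩ := X.exists_eq_triangle w
    have h0 : X.edge l = X.edge f := hw 0
    have h1 := (X.d_one_triangle k a l).symm.trans (hw (Fin.succ 0))
    have h2 := (X.d_two_triangle k a l).symm.trans (hw (Fin.succ (Fin.succ 0)))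
    obtain rfl : y = t := X.vertex_injective (congrArg (X.nerve.d (Fin.succ 0)) h0)
    obtain rfl : z = y := X.vertex_injective (congrArg (X.nerve.d 0) h0)
    obtain rfl : x = z := X.vertex_injective (congrArg (X.nerve.d (Fin.succ 0)) h2)
    obtain rfl := X.edge_injective h0
    obtain rfl := X.edge_injective h2
    exact ⟨a, X.edge_injective h1⟩
  · rintro ⟨a, rfl⟩
    exact ⟨X.triangle h a f, forall_fin_three.2
      ⟨X.d_zero_triangle _ _ _, X.d_one_triangle _ _ _, X.d_two_triangle _ _ _⟩⟩

/-- The `2`-sphere given by an element of the kernel of `∂`. -/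
def triangleSphere {t : C} (a : (X.bd t).ker) :
    SimpSet.Sphere (X := X.nerve) 1 (X.vertex t) :=
  ⟨X.triangle (𝟙 t) a (𝟙 t), forall_fin_three.2 ⟨X.d_zero_triangle _ _ _, by
    rw [d_one_triangle, a.2, End.one_def, Category.comp_id, Category.comp_id, pt_one],
    X.d_two_triangle _ _ _⟩⟩

theorem triangle_injective {x y z : C} {g g' : y ⟶ x} {a a' : A y} {h h' : z ⟶ y}
    (e : X.triangle g a h = X.triangle g' a' h') : a = a' :=
  congrFun (TriMat.cons_inj (eq_of_heq (Sigma.mk.inj e).2)).2.1 0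

theorem triangleSphere_injective (t : C) :
    Function.Injective (X.triangleSphere : (X.bd t).ker → _) :=
  fun _ _ h => Subtype.ext (X.triangle_injective (congrArg Subtype.val h))

/-- The faces d₀ and d₂ force the diagonal entries to be identities; d₁ then says that ∂ kills the
remaining entry. -/
theorem triangleSphere_surjective (t : C) :
    Function.Surjective (X.triangleSphere : (X.bd t).ker → _) := by
  rintro ⟨w, hw⟩
  obtain ⟨x, y, z, k, a, l, rfl⟩ := X.exists_eq_triangle w
  have h0 : X.edge l = X.edge (𝟙 t) := hw 0
  have h1 := (X.d_one_triangle k a l).symm.trans (hw (Fin.succ 0))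
  have h2 := (X.d_two_triangle k a l).symm.trans (hw (Fin.succ (Fin.succ 0)))
  obtain rfl : y = t := X.vertex_injective (congrArg (X.nerve.d (Fin.succ 0)) h0)
  obtain rfl : z = y := X.vertex_injective (congrArg (X.nerve.d 0) h0)
  obtain rfl : x = z := X.vertex_injective (congrArg (X.nerve.d (Fin.succ 0)) h2)
  obtain rfl : l = 𝟙 x := X.edge_injective h0
  obtain rfl : k = 𝟙 x := X.edge_injective h2
  have e : 𝟙 x ≫ X.bd x a ≫ 𝟙 x = 𝟙 x := X.edge_injective h1
  rw [Category.comp_id, Category.id_comp] at e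
  exact ⟨⟨a, e⟩, rfl⟩

theorem tri_triangleSphere {t : C} (a b : (X.bd t).ker) :
    SimpSet.Tri (X.triangleSphere a) (X.triangleSphere (a * b)) (X.triangleSphere b) := by
  -- By the Peiffer identity, elements of Ker ∂ are central.
  have comm : (a : A t) * b = b * a := by
    have h : X.bd t (b : A t) = 𝟙 t := b.2
    rw [X.peiffer, h, X.act_id]
  -- The first row (1, b, a) is dictated by d₃, which keeps `b`, and d₁, which keeps `a`. Then d₂
  -- has entry `b * a`, equal to `a * b` by centrality.
  refine ⟨⟨t, cons (𝟙 t) (Fin.cons (b : A t) fun _ => a)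
    (cons (𝟙 t) (fun _ => 1) (cons (𝟙 t) (fun _ => 1) (nil t)))⟩, ?_⟩
  rw [Fin.forall_fin_succ, forall_fin_three]
  refine ⟨?_, ?_, ?_, ?_⟩
  · refine congrArg (Sigma.mk t) ?_
    congr 1
  · refine X.nerve_d_succ_eq ?_
    rw [face_zero_cons]
    congr 1
    · rw [Fin.cons_zero, show X.bd t (b : A t) = 𝟙 t from b.2, Category.comp_id, Category.comp_id]
    · funext i
      rw [Fin.fin_one_eq_zero i, mergeRow_zero, X.act_id, mul_one]
      rfl
  · refine X.nerve_d_succ_eq ?_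
    rw [face_succ_cons, face_zero_cons, map_one, End.one_def, Category.comp_id,
      Category.comp_id]
    congr 1
    · funext i
      rw [Fin.fin_one_eq_zero i, contractNth_zero_zero]
      exact comm.symm
    · congr 1
      exact funext fun i => i.elim0
  · refine X.nerve_d_succ_eq ?_
    rw [face_succ_cons, face_succ_cons]
    congr 1
    · funext i
      rw [Fin.fin_one_eq_zero i, contractNth_succ_zero]
      rfl
    · congr 1
      exact funext fun i => i.elim0

/-! ### The isomorphisms for π₁ and π₂ -/

/-- The homomorphism from `C(t, t)` to the fundamental group sending `g` to the class of `g⁻¹`. -/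
noncomputable def endToHomotopyGroup [X.nerve.IsKan] (t : C) :
    End t →* X.nerve.HomotopyGroup 0 (X.vertex t) :=
  MonoidHom.mk' (fun g => SimpSet.HomotopyGroup.mk (X.edgeSphere g⁻¹)) fun f g =>
    (SimpSet.mk_mul_mk ((X.tri_edgeSphere_iff _ _ _).2 ⟨1, by
      rw [map_one, mul_one, mul_inv_rev]⟩)).symm

theorem endToHomotopyGroup_surjective [X.nerve.IsKan] (t : C) :
    Function.Surjective (X.endToHomotopyGroup t) := by
  rintro ⟨y⟩
  obtain ⟨g, rfl⟩ := X.exists_eq_edgeSphere y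
  refine ⟨g⁻¹, ?_⟩
  change SimpSet.HomotopyGroup.mk (X.edgeSphere g⁻¹⁻¹) = _
  rw [inv_inv]
  rfl

/-- A homotopy from the loop of `g⁻¹` to the constant one is a triangle whose entry `a` satisfies ∂a
= g⁻¹, and the image of ∂ is closed under inverses. -/
theorem ker_endToHomotopyGroup [X.nerve.IsKan] (t : C) :
    (X.endToHomotopyGroup t).ker = (X.bd t).range := by
  ext g
  have h : X.endToHomotopyGroup t g = 1 ↔ (X.edgeSphere g⁻¹).Rel (X.edgeSphere 1) :=
    SimpSet.HomotopyGroup.mk_eq_mk_iff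
  rw [MonoidHom.mem_ker, h, SimpSet.Sphere.Rel, ← edgeSphere_one, tri_edgeSphere_iff]
  simp only [one_mul, mul_one]
  rw [← inv_mem_iff]
  rfl

/-- The kernel of `∂` is the second homotopy group. -/
noncomputable def kerEquivHomotopyGroup [X.nerve.IsKan] (t : C) :
    (X.bd t).ker ≃* X.nerve.HomotopyGroup 1 (X.vertex t) :=
  MulEquiv.ofBijective
    (MonoidHom.mk' (fun a => SimpSet.HomotopyGroup.mk (X.triangleSphere a)) fun a b =>
      (SimpSet.mk_mul_mk (X.tri_triangleSphere a b)).symm)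
    ⟨fun _ _ h => X.triangleSphere_injective t
      (X.eq_of_sphere_rel (SimpSet.HomotopyGroup.mk_eq_mk_iff.1 h)),
      by
        rintro ⟨y⟩
        obtain ⟨a, rfl⟩ := X.triangleSphere_surjective t y
        exact ⟨a, rfl⟩⟩

end CrossedMonoid

theorem mainTheorem6 {C : Type u} [Groupoid.{v} C] {A : C → Type w} [∀ t, Group (A t)]
    (X : CrossedMonoid C A) :
    ∃ _ : X.nerve.IsKan,
      (∀ t : C,
        Nonempty (X.nerve.HomotopyGroup 0 (X.vertex t) ≃* End t ⧸ (X.bd t).range) ∧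
        Nonempty (X.nerve.HomotopyGroup 1 (X.vertex t) ≃* (X.bd t).ker)) ∧
      (∀ n : ℕ, 2 ≤ n → ∀ t : C, Subsingleton (X.nerve.HomotopyGroup n (X.vertex t))) ∧
      X.nerve.IsType 2 := by
  have hX := X.nerve_isKan
  -- With the index shift of `HomotopyGroup`, `2 ≤ n` covers exactly π₃ and above.
  have hn : ∀ n : ℕ, 2 ≤ n → ∀ x, Subsingleton (X.nerve.HomotopyGroup n x) := fun n hn x => by
    obtain ⟨n, rfl⟩ := Nat.exists_eq_add_of_le' hn
    exact X.subsingleton_homotopyGroup n x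
  refine ⟨hX, fun t => ⟨⟨?_⟩, ⟨(X.kerEquivHomotopyGroup t).symm⟩⟩, fun n h t => hn n h _,
    hX, fun n h x => hn n (Nat.lt_succ_iff.1 h) x⟩
  -- The first isomorphism theorem for `endToHomotopyGroup`.
  exact ((QuotientGroup.quotientMulEquivOfEq (X.ker_endToHomotopyGroup t).symm).trans
    (QuotientGroup.quotientKerEquivOfSurjective _ (X.endToHomotopyGroup_surjective t))).symm
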